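/- Let $p$ be an odd prime, let $m>k\ge 1$ be integers with $m\ne 2k$, put $d=\gcd(k,m)$, let $\upsilon_2$ denote the $2$-adic order function, and let $\alpha$ be a primitive element of $\mathbb{F}_{p^m}$. Let $h_1(x)$ be the minimal polynomial of $\alpha^{-(p^k+1)}$ over $\mathbb{F}_p$. Then $(x-1)h_1(x)$ divides $x^{p^m-1}-1$. Let $C_2$ be the code over $\mathbb{F}_p$ of length $n=p^m-1$ with parity-check polynomial $(x-1)h_1(x)$, that is, the ideal of $\mathbb{F}_p[x]/(x^n-1)$ generated by $(x^n-1)/((x-1)h_1(x))$, a word $(c_0,\dots,c_{n-1})\in\mathbb{F}_p^n$ being identified with the class of $c_0+c_1x+\cdots+c_{n-1}x^{n-1}$. Let $A_i$ be the number of codewords of $C_2$ of Hamming weight $i$. Then $C_2$ is a cyclic code of dimension $m+1$ over $\mathbb{F}_p$, and its weight distribution is as follows, where $A_i=0$ for every $i$ that is not listed. 1. If $0=\upsilon_2(m)\le\upsilon_2(k)$, then $$\begin{aligned} &A_0=1,\qquad A_{p^m-1}=p-1,\qquad A_{(p-1)p^{m-1}}=p^m-1,\\ &A_{(p-1)p^{m-1}-p^{\frac{m-1}{2}}-1}=A_{(p-1)p^{m-1}+p^{\frac{m-1}{2}}-1}=\tfrac{p-1}{2}(p^m-1).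 \end{aligned}$$ 2. If $1\le\upsilon_2(m)\le\upsilon_2(k)$, then $$\begin{aligned} &A_0=1,\qquad A_{p^m-1}=p-1,\\ &A_{(p-1)p^{m-1}-p^{\frac{m-2}{2}}-1}=A_{(p-1)p^{m-1}+p^{\frac{m-2}{2}}-1}=\tfrac{p-1}{2}(p^m-1),\\ &A_{(p-1)(p^{m-1}-p^{\frac{m-2}{2}})}=A_{(p-1)(p^{m-1}+p^{\frac{m-2}{2}})}=\tfrac{1}{2}(p^m-1). \end{aligned}$$ 3. If $\upsilon_2(m)=\upsilon_2(k)+1$, then $$\begin{aligned} &A_0=1,\qquad A_{p^m-1}=p-1,\\ &A_{(p-1)(p^{m-1}+p^{\frac{m-2}{2}})}=\tfrac{p^d(p^m-1)}{p^d+1},\qquad A_{(p-1)p^{m-1}-p^{\frac{m-2}{2}}-1}=\tfrac{p^d(p-1)(p^m-1)}{p^d+1},\\ &A_{(p-1)(p^{m-1}-p^{\frac{m+2d-2}{2}})}=\tfrac{p^m-1}{p^d+1},\qquad A_{(p-1)p^{m-1}+p^{\frac{m+2d-2}{2}}-1}=\tfrac{(p-1)(p^m-1)}{p^d+1}. \end{aligned}$$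 4. If $\upsilon_2(m)>\upsilon_2(k)+1$, then $$\begin{aligned} &A_0=1,\qquad A_{p^m-1}=p-1,\\ &A_{(p-1)(p^{m-1}-p^{\frac{m-2}{2}})}=\tfrac{p^d(p^m-1)}{p^d+1},\qquad A_{(p-1)p^{m-1}+p^{\frac{m-2}{2}}-1}=\tfrac{p^d(p-1)(p^m-1)}{p^d+1},\\ &A_{(p-1)(p^{m-1}+p^{\frac{m+2d-2}{2}})}=\tfrac{p^m-1}{p^d+1},\qquad A_{(p-1)p^{m-1}-p^{\frac{m+2d-2}{2}}-1}=\tfrac{(p-1)(p^m-1)}{p^d+1}. \end{aligned}$$ In every case $C_2$ has at most five nonzero weights. -/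

import Mathlib

open Polynomial

namespace CyclicCodes

/-- The polynomial `c₀ + c₁ x + ⋯ + c_{n-1} x^{n-1}` of a word `c = (c₀, …, c_{n-1})`. -/
noncomputable def wordPoly (F : Type*) [Field F] (n : ℕ) : (Fin n → F) →ₗ[F] F[X] :=
  ∑ i : Fin n, (Polynomial.monomial (i : ℕ)).comp (LinearMap.proj i)

/-- The ideal `(x^n - 1)` of `F[x]`. -/
noncomputable def lengthIdeal (F : Type*) [Field F] (n : ℕ) : Ideal F[X] :=
  Ideal.span {(X ^ n - 1 : F[X])}

/-- The identification of words of length `n` with residue classes in `F[x]/(x^n - 1)`. -/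
noncomputable def wordClass (F : Type*) [Field F] (n : ℕ) :
    (Fin n → F) →ₗ[F] (F[X] ⧸ lengthIdeal F n) :=
  (Ideal.Quotient.mkₐ F (lengthIdeal F n)).toLinearMap.comp (wordPoly F n)

/-- The code of length `n` with parity-check polynomial `h` (a monic divisor of `x^n - 1`):
the ideal of `F[x]/(x^n - 1)` generated by the generator polynomial `g = (x^n - 1)/h`,
viewed as a linear subspace of `F^n`. -/
noncomputable def codeOfParityCheck {F : Type*} [Field F] (n : ℕ) (h : F[X]) :
    Submodule F (Fin n → F) :=
  ((Ideal.span {Ideal.Quotient.mk (lengthIdeal F n) ((X ^ n - 1) / h)}).restrictScalars F).comap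
    (wordClass F n)

/-- A linear code is cyclic if it contains the cyclic shift
`(c_{n-1}, c₀, …, c_{n-2})` of each of its words `(c₀, …, c_{n-1})`. -/
def IsCyclicCode {F : Type*} [Field F] {n : ℕ} (C : Submodule F (Fin n → F)) : Prop :=
  ∀ c ∈ C, (fun i => c ((finRotate n).symm i)) ∈ C

/-- The number `A_w` of codewords of Hamming weight `w`. -/
noncomputable def weightCount {F : Type*} [Field F] [DecidableEq F] {n : ℕ}
    (C : Submodule F (Fin n → F)) (w : ℕ) : ℕ :=
  {c : Fin n → F | c ∈ C ∧ hammingNorm c = w}.ncard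

/-- The weight distribution of `C` is given by a list of pairs `(w, A_w)`:
each listed pair is correct, and `A_w = 0` for every weight `w` that is not listed. -/
def HasWeightDistribution {F : Type*} [Field F] [DecidableEq F] {n : ℕ}
    (C : Submodule F (Fin n → F)) (L : List (ℕ × ℕ)) : Prop :=
  (∀ e ∈ L, weightCount C e.1 = e.2) ∧ ∀ w, w ∉ L.map Prod.fst → weightCount C w = 0

/-- The minimal polynomial `h₁` of `α^{-(p^k+1)}` over the field with `p` elements. -/
noncomputable def h₁ (p k : ℕ) [Fact p.Prime] {K : Type*} [Field K] [Algebra (ZMod p) K]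
    (α : Kˣ) : (ZMod p)[X] :=
  minpoly (ZMod p) (((α ^ (p ^ k + 1))⁻¹ : Kˣ) : K)

/-- The code `C₂` of length `p^m - 1` with parity-check polynomial `(x - 1) h₁(x)`. -/
noncomputable def C₂ (p m k : ℕ) [Fact p.Prime] {K : Type*} [Field K] [Algebra (ZMod p) K]
    (α : Kˣ) : Submodule (ZMod p) (Fin (p ^ m - 1) → ZMod p) :=
  codeOfParityCheck (p ^ m - 1) ((X - 1) * h₁ p k α)

end CyclicCodes

namespace CyclicCodes

/-! Write q for p^d and θ for α^(p^k+1). The words (Tr(aθ^i)+b)_i lie in the code, since over K such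
a word is a sum of Frobenius conjugates of a geometric word killed by the check polynomial. The code
has dimension at most deg h₁ + 1 ≤ m+1, so once (a,b) ↦ word is injective these words are the whole
code (`codeOfParityCheck_eq_range`). Injectivity is read off from the weights, all nonzero for (a,b)
≠ 0.

The weight of the word is p^m-1 minus the number of nonzero solutions of Tr(a x^(p^k+1)) = -b
(`hammingNorm_traceWord`). Solution counts do not change when the exponent is replaced by its gcd e
with p^m-1 (`levelCount_gcd`); e is 2 if m/d is odd and q+1 if m/d is even. As e = p^j+1, Tr(a x^e)
is a quadratic form, and the sum of the squares of its level counts depends only on the size of its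
radical (`sum_levelCount_sq`).

If (p-1)e divides p^m-1, every element of F_p^* is an e-th power in K, so all nonzero levels have
equal size and a single deviation D remains, with pD² = |rad| p^(m-1). For e = q+1 the radical has 1
or q² elements, and q+1 divides the number of solutions at level 1, which fixes the sign of D
(`deviation_eq`). The frequencies follow from ∑ D = 0 over a ≠ 0. For m odd the divisibility fails;
instead a nonsquare of F_p remains a nonsquare in K, which makes level 0 balanced and the other
levels deviate by ±p^((m-1)/2). -/

/-- The number of solutions `x` of `Tr(a x^e) = t`. -/
noncomputable def levelCount {p : ℕ} {K : Type*} [Field K] [Fintype K] [Algebra (ZMod p) K]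
    (e : ℕ) (a : K) (t : ZMod p) : ℕ :=
  (Finset.univ.filter fun x : K => Algebra.trace (ZMod p) K (a * x ^ e) = t).card

/-- Substitute cx for x: the counts depend on a only modulo e-th powers. -/
lemma levelCount_pow_mul {p : ℕ} {K : Type*} [Field K] [Fintype K]
    [Algebra (ZMod p) K] {e : ℕ} {c : K} (hc : c ≠ 0) (a : K) (t : ZMod p) :
    levelCount e (c ^ e * a) t = levelCount e a t := by
  refine Finset.card_equiv (Equiv.mulLeft₀ c hc) fun x => ?_
  simp [mul_pow, mul_left_comm, mul_assoc]

/-! ### First and second moments of the level counts -/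

section Counting

variable {p : ℕ} [Fact p.Prime] {K : Type*} [Field K] [Fintype K] [Algebra (ZMod p) K]

lemma trace_pow_prime_pow (j : ℕ) (x : K) :
    Algebra.trace (ZMod p) K (x ^ p ^ j) = Algebra.trace (ZMod p) K x := by
  induction j with
  | zero => simp
  | succ j ih =>
    rw [pow_succ, pow_mul, ← ih]
    have := Algebra.trace_eq_of_algEquiv (FiniteField.frobeniusAlgEquivOfAlgebraic (ZMod p) K)
      (x ^ p ^ j)
    simpa [FiniteField.frobeniusAlgEquivOfAlgebraic] using this

/-- The trace is onto, so any two fibres are translates of each other. -/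
lemma card_trace_mul_eq {m : ℕ} (hK : Fintype.card K = p ^ m) (hm : 0 < m) {w : K} (hw : w ≠ 0)
    (t : ZMod p) :
    (Finset.univ.filter fun y : K => Algebra.trace (ZMod p) K (w * y) = t).card = p ^ (m - 1) := by
  have hp : 0 < p := (Fact.out : p.Prime).pos
  have key : ∀ s : ZMod p,
      (Finset.univ.filter fun y : K => Algebra.trace (ZMod p) K (w * y) = s).card =
      (Finset.univ.filter fun y : K => Algebra.trace (ZMod p) K (w * y) = t).card := by
    intro s
    obtain ⟨v, hv⟩ := Algebra.trace_surjective (ZMod p) K (s - t)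
    refine Finset.card_equiv (Equiv.subRight (w⁻¹ * v)) fun y => ?_
    simp only [Finset.mem_filter, Finset.mem_univ, true_and, Equiv.subRight_apply, mul_sub,
      mul_inv_cancel_left₀ hw, map_sub, hv]
    constructor
    · rintro rfl; ring
    · intro h
      linear_combination h
  have h := Finset.card_eq_sum_card_fiberwise (s := (Finset.univ : Finset K))
    (t := (Finset.univ : Finset (ZMod p))) (f := fun y => Algebra.trace (ZMod p) K (w * y))
    (by intro x _; simp)
  rw [Finset.sum_congr rfl fun s _ => key s] at h
  simp only [Finset.card_univ, hK, Finset.sum_const, ZMod.card, smul_eq_mul] at h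
  obtain ⟨r, rfl⟩ : ∃ r, m = r + 1 := ⟨m - 1, by omega⟩
  rw [pow_succ'] at h
  simpa using (Nat.eq_of_mul_eq_mul_left hp h).symm

lemma levelCount_zero {e : ℕ} (t : ZMod p) :
    levelCount e (0 : K) t = if t = 0 then Fintype.card K else 0 := by
  unfold levelCount
  split_ifs with h
  · simp [h]
  · simp [Ne.symm h]

/-- Exchange the sums over a and x. Each x ≠ 0 contributes a balanced count, while x = 0 contributes
exactly the term a = 0 that the sum omits. -/
lemma sum_levelCount_ne_zero [DecidableEq K] {m : ℕ} (hK : Fintype.card K = p ^ m) (hm : 0 < m)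
    {e : ℕ} (he : e ≠ 0) (t : ZMod p) :
    ∑ a ∈ Finset.univ.filter (fun a : K => a ≠ 0), levelCount e a t
      = (p ^ m - 1) * p ^ (m - 1) := by
  have h1 : ∑ a : K, levelCount e a t =
      (if t = 0 then Fintype.card K else 0) + (p ^ m - 1) * p ^ (m - 1) := by
    unfold levelCount
    simp_rw [Finset.card_filter]
    rw [Finset.sum_comm]
    simp_rw [← Finset.card_filter]
    rw [← Finset.add_sum_erase _ _ (Finset.mem_univ (0 : K))]
    congr 1
    · simp only [ne_eq, he, not_false_eq_true, zero_pow, mul_zero, map_zero]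
      split_ifs with h
      · simp [h]
      · simp [Ne.symm h]
    · rw [Finset.sum_congr rfl fun x hx => ?_, Finset.sum_const, Finset.card_erase_of_mem
        (Finset.mem_univ _), Finset.card_univ, hK, smul_eq_mul]
      simp_rw [mul_comm _ (x ^ e)]
      exact card_trace_mul_eq hK hm (pow_ne_zero _ (Finset.ne_of_mem_erase hx)) t
  rw [← Finset.add_sum_erase _ _ (Finset.mem_univ (0 : K)), levelCount_zero] at h1
  rw [Finset.filter_ne']
  exact Nat.add_left_cancel h1

lemma sum_levelCount (e : ℕ) (a : K) :
    ∑ t : ZMod p, levelCount e a t = Fintype.card K := by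
  rw [← Finset.card_univ]
  exact (Finset.card_eq_sum_card_fiberwise (by intro x _; simp)).symm

lemma levelCount_smul {e : ℕ} {c : ZMod p} (hc : c ≠ 0) (a : K) (t : ZMod p) :
    levelCount e (algebraMap (ZMod p) K c * a) (c * t) = levelCount e a t := by
  refine Finset.card_equiv (Equiv.refl K) fun x => ?_
  simp [← Algebra.smul_def, hc]

/-- The radical of the quadratic form `x ↦ Tr(a x^(q+1))`, `q` a power of the characteristic. -/
noncomputable def radicalCard (q : ℕ) (a : K) : ℕ := by
  classical
  exact (Finset.univ.filter fun z : K => a ^ q * z ^ q ^ 2 + a * z = 0).card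

/-- The left side counts pairs with Q(x) = Q(y). Put x = z + y: the condition reads Q(z) + Tr(w(z)
y^q) = 0, which is balanced in y when w(z) ≠ 0 and holds for every y when z is in the radical. -/
lemma sum_levelCount_sq (hp : p ≠ 2) {m : ℕ} (hK : Fintype.card K = p ^ m) (hm : 0 < m) (j : ℕ)
    (a : K) :
    (∑ t : ZMod p, (levelCount (p ^ j + 1) a t : ℤ) ^ 2) =
      ((p : ℤ) ^ m - radicalCard (p ^ j) a) * p ^ (m - 1) + radicalCard (p ^ j) a * p ^ m := by
  classical
  have : CharP K p := charP_of_injective_algebraMap (algebraMap (ZMod p) K).injective p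
  set T := Algebra.trace (ZMod p) K
  set q := p ^ j with hq
  set Q : K → ZMod p := fun x => T (a * x ^ (q + 1)) with hQ
  set w : K → K := fun z => a ^ q * z ^ q ^ 2 + a * z with hw
  have hfrob : Function.Bijective (fun y : K => y ^ q) := by
    refine Finite.injective_iff_bijective.mp ?_
    intro x y hxy
    exact iterateFrobenius_inj K p j (by simpa [iterateFrobenius_def] using hxy)
  have hadd : ∀ z y : K, Q (z + y) = Q z + Q y + T (w z * y ^ q) := by
    intro z y
    -- Apply Frobenius under the trace so that both cross terms become linear in y^q.
    have e1 : T (a * (z ^ q * y)) = T (a ^ q * z ^ q ^ 2 * y ^ q) := by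
      rw [← trace_pow_prime_pow j (a * (z ^ q * y)), ← hq]
      congr 1; ring
    have e2 : a * (z + y) ^ (q + 1) = a * z ^ (q + 1) + a * y ^ (q + 1)
        + (a * (z ^ q * y) + a * z * y ^ q) := by
      rw [pow_succ (z + y), hq, add_pow_char_pow]; ring
    simp only [hQ, hw]
    rw [e2, map_add, map_add, map_add, e1, add_mul, map_add]
  -- On the radical Q(2z) is 2Q(z) by `hadd` and 4Q(z) by homogeneity; p is odd.
  have hrad : ∀ z, w z = 0 → Q z = 0 := by
    intro z hz
    have h1 := hadd z z
    have h2 : Q (z + z) = 4 * Q z := by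
      simp only [hQ]
      have : a * (z + z) ^ (q + 1) = (4 : ZMod p) • (a * z ^ (q + 1)) := by
        rw [Algebra.smul_def, ← two_mul, mul_pow]
        have : (2 : K) ^ (q + 1) = algebraMap (ZMod p) K 4 := by
          rw [pow_succ]
          have : (2 : ZMod p) ^ q = 2 := by rw [hq, ZMod.pow_card_pow]
          have : (2 : K) ^ q = 2 := by
            have := congrArg (algebraMap (ZMod p) K) this
            rwa [map_pow, map_ofNat] at this
          rw [this]; simp only [map_ofNat]; norm_num
        rw [this]; ring
      rw [this, map_smul, smul_eq_mul]
    rw [h2, hz] at h1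
    have h3 : (2 : ZMod p) * Q z = 0 := by
      simp at h1
      linear_combination h1
    have h4 : (2 : ZMod p) ≠ 0 := by
      have := ZMod.natCast_eq_zero_iff 2 p
      intro h
      rw [show ((2 : ℕ) : ZMod p) = 2 by norm_cast, h] at this
      have h5 : p ∣ 2 := this.mp rfl
      exact hp ((Nat.prime_dvd_prime_iff_eq Fact.out Nat.prime_two).mp h5)
    exact (mul_eq_zero.mp h3).resolve_left h4
  have hcount : ∀ z, (Finset.univ.filter fun y : K => Q (z + y) = Q y).card =
      if w z = 0 then p ^ m else p ^ (m - 1) := by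
    intro z
    split_ifs with h
    · simp [hadd, h, hrad z h, hK]
    · rw [← card_trace_mul_eq hK hm h (-Q z)]
      refine Finset.card_equiv (Equiv.ofBijective _ hfrob) fun y => ?_
      simp only [Finset.mem_filter, Finset.mem_univ, true_and, hadd, Equiv.ofBijective_apply]
      constructor
      · intro h; linear_combination h
      · intro h
        have h : T (w z * y ^ q) = - Q z := h
        linear_combination h
  have hsum : (∑ t : ZMod p, (levelCount (q + 1) a t : ℤ) ^ 2) =
      ∑ z : K, ((if w z = 0 then p ^ m else p ^ (m - 1) : ℕ) : ℤ) := by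
    have e1 : ∀ t : ZMod p, (levelCount (q + 1) a t : ℤ) ^ 2 =
        ∑ y : K, ∑ x : K, if Q y = t then if Q x = t then 1 else 0 else 0 := by
      intro t
      have : (levelCount (q + 1) a t : ℤ) = ∑ y : K, if Q y = t then 1 else 0 := by
        simp [levelCount, hQ, T]
      rw [sq, this, Finset.sum_mul_sum]
      refine Finset.sum_congr rfl fun y _ => Finset.sum_congr rfl fun x _ => ?_
      split_ifs <;> simp
    rw [Finset.sum_congr rfl fun t _ => e1 t, Finset.sum_comm]
    have e2 : ∀ y : K, ∑ t : ZMod p, ∑ x : K, (if Q y = t then if Q x = t then (1:ℤ) else 0 else 0)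
        = ∑ z : K, if Q (z + y) = Q y then 1 else 0 := by
      intro y
      rw [Finset.sum_comm, ← Equiv.sum_comp (Equiv.addRight y)]
      refine Finset.sum_congr rfl fun z _ => ?_
      simp only [Equiv.coe_addRight, Finset.sum_ite_eq, Finset.mem_univ, if_true]
      by_cases h : Q (z + y) = Q y <;> simp [h]
    rw [Finset.sum_congr rfl fun t _ => e2 t, Finset.sum_comm]
    refine Finset.sum_congr rfl fun z _ => ?_
    rw [← hcount z]
    simp
  rw [hsum]
  push_cast
  rw [Finset.sum_ite]
  simp only [Finset.sum_const, nsmul_eq_mul]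
  have hR : (Finset.univ.filter fun z : K => w z = 0).card = radicalCard q a := by
    unfold radicalCard; congr
  have hR' := Finset.card_filter_add_card_filter_not (s := (Finset.univ : Finset K))
    (fun z : K => w z = 0)
  rw [hR, Finset.card_univ, hK] at hR'
  rw [hR]
  have : ((Finset.univ.filter fun z : K => ¬ w z = 0).card : ℤ) = (p : ℤ) ^ m - radicalCard q a := by
    rw [eq_sub_iff_add_eq']; exact_mod_cast hR'
  rw [this]; ring

end Counting

/-! ### Power maps on a finite field -/

section Powers

variable {K : Type*} [Field K] [Fintype K]

lemma exists_isPrimitiveRoot_of_dvd {e : ℕ} (he : e ∣ Fintype.card K - 1) :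
    ∃ ζ : K, IsPrimitiveRoot ζ e := by
  classical
  obtain ⟨g, hg⟩ := IsCyclic.exists_ofOrder_eq_natCard (α := Kˣ)
  rw [Nat.card_eq_fintype_card, Fintype.card_units] at hg
  have h1 : IsPrimitiveRoot (g : K) (Fintype.card K - 1) := by
    rw [IsPrimitiveRoot.coe_units_iff, ← hg]
    exact IsPrimitiveRoot.orderOf g
  obtain ⟨f, hf⟩ := he
  exact ⟨g ^ f, h1.pow (by have := Fintype.one_lt_card (α := K); omega) (by rw [hf, mul_comm])⟩

lemma card_filter_pow_eq [DecidableEq K] {e : ℕ} (he : e ∣ Fintype.card K - 1) {y : K}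
    (hy : y ≠ 0) :
    (Finset.univ.filter fun x : K => x ^ e = y).card = 0 ∨
      (Finset.univ.filter fun x : K => x ^ e = y).card = e := by
  obtain ⟨ζ, hζ⟩ := exists_isPrimitiveRoot_of_dvd he
  have he0 : 0 < e := Nat.pos_of_dvd_of_pos he (by have := Fintype.one_lt_card (α := K); omega)
  have h : (Finset.univ.filter fun x : K => x ^ e = y) = (nthRoots e y).toFinset := by
    ext x
    simp [mem_nthRoots he0]
  rw [h, Multiset.toFinset_card_of_nodup (hζ.nthRoots_nodup hy), hζ.card_nthRoots]
  split_ifs <;> simp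

/-- Write c = g^j for a generator g of K^*. From c^(p-1) = 1 follows (p-1)e ∣ (p-1)j, so e ∣ j. -/
lemma exists_pow_eq_algebraMap {p : ℕ} [Fact p.Prime] [Algebra (ZMod p) K] {e : ℕ}
    (he : (p - 1) * e ∣ Fintype.card K - 1) {c : ZMod p} (hc : c ≠ 0) :
    ∃ b : K, b ≠ 0 ∧ b ^ e = algebraMap (ZMod p) K c := by
  classical
  obtain ⟨g, hg⟩ := IsCyclic.exists_generator (α := Kˣ)
  have hcard : orderOf g = Fintype.card K - 1 := by
    rw [orderOf_eq_card_of_forall_mem_zpowers hg, Nat.card_eq_fintype_card, Fintype.card_units]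
  have hc' : algebraMap (ZMod p) K c ≠ 0 := by simpa using hc
  obtain ⟨j, hj⟩ := (Submonoid.mem_powers_iff _ _).mp
    (mem_powers_iff_mem_zpowers.mpr (hg (Units.mk0 _ hc')))
  have h1 : (g ^ j) ^ (p - 1) = 1 := by
    rw [hj]
    ext
    simp only [Units.val_pow_eq_pow_val, Units.val_mk0, Units.val_one, ← map_pow,
      ZMod.pow_card_sub_one_eq_one hc, map_one]
  rw [← pow_mul, ← orderOf_dvd_iff_pow_eq_one, hcard, mul_comm j] at h1
  have hp : 0 < p - 1 := by have := (Fact.out : p.Prime).two_le; omega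
  obtain ⟨i, rfl⟩ := Nat.dvd_of_mul_dvd_mul_left hp (he.trans h1)
  refine ⟨(g ^ i : Kˣ), Units.ne_zero _, ?_⟩
  rw [← Units.val_pow_eq_pow_val, ← pow_mul, mul_comm i, hj, Units.val_mk0]

/-- Modulo n = |K|-1 the exponent j is a unit times gcd(j,n), and an exponent prime to n permutes K.
-/
lemma exists_coprime_pow_eq {j : ℕ} (hj : 0 < j) :
    ∃ u : ℕ, Function.Bijective (fun x : K => x ^ u) ∧
      ∀ x : K, x ^ j = (x ^ u) ^ (j.gcd (Fintype.card K - 1)) := by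
  classical
  set n := Fintype.card K - 1 with hn
  have hn0 : 0 < n := by have := Fintype.one_lt_card (α := K); omega
  have : NeZero n := ⟨hn0.ne'⟩
  obtain ⟨d, hd, u, hu, hju⟩ := ZMod.eq_unit_mul_divisor (j : ZMod n)
  obtain ⟨u, rfl⟩ := hu
  -- Adding n keeps the residue and makes v positive even for n = 1, so that 0 ^ v = 0.
  set v := (u : ZMod n).val + n with hv
  have hcop : v.Coprime n := by
    rw [hv, Nat.coprime_add_self_left]
    exact ZMod.val_coe_unit_coprime u
  have hmod : j ≡ v * d [MOD n] := by
    rw [← ZMod.natCast_eq_natCast_iff, hju]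
    simp [hv]
  have hgcd : j.gcd n = d := by
    rw [hmod.gcd_eq, Nat.Coprime.gcd_mul_left_cancel _ hcop]
    exact Nat.gcd_eq_left hd
  have hv0 : v ≠ 0 := by omega
  have hd0 : d ≠ 0 := (Nat.pos_of_dvd_of_pos hd hn0).ne'
  refine ⟨v, ?_, fun x => ?_⟩
  · refine Finite.injective_iff_bijective.mp fun x y hxy => ?_
    replace hxy : x ^ v = y ^ v := hxy
    rcases eq_or_ne x 0 with rfl | hx
    · rw [zero_pow hv0] at hxy
      exact (pow_eq_zero_iff hv0 |>.mp hxy.symm).symm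
    · have hy : y ≠ 0 := by
        rintro rfl
        rw [zero_pow hv0] at hxy
        exact hx (pow_eq_zero_iff hv0 |>.mp hxy)
      have hc : (Nat.card Kˣ).Coprime v := by
        rw [Nat.card_eq_fintype_card, Fintype.card_units]
        exact hcop.symm
      have := (powCoprime hc).injective (a₁ := Units.mk0 x hx) (a₂ := Units.mk0 y hy)
        (by ext; simpa using hxy)
      simpa using congrArg Units.val this
  · rw [hgcd]
    rcases eq_or_ne x 0 with rfl | hx
    · rw [zero_pow hv0, zero_pow hd0, zero_pow hj.ne']
    · rw [← pow_mul]
      have hx1 : x ^ n = 1 := FiniteField.pow_card_sub_one_eq_one x hx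
      exact pow_eq_pow_of_modEq hmod hx1

lemma levelCount_gcd {p : ℕ} [Algebra (ZMod p) K] {j : ℕ} (hj : 0 < j) (a : K) (t : ZMod p) :
    levelCount j a t = levelCount (j.gcd (Fintype.card K - 1)) a t := by
  obtain ⟨u, hu, h⟩ := exists_coprime_pow_eq (K := K) hj
  refine Finset.card_equiv (Equiv.ofBijective _ hu) fun x => ?_
  simp [h]

/-- As t ≠ 0, the solutions are a union of fibres of x ↦ x^e over nonzero points, and each such
fibre has 0 or e elements. -/
lemma dvd_levelCount {p : ℕ} [Algebra (ZMod p) K] {e : ℕ} (he : e ∣ Fintype.card K - 1) (a : K)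
    {t : ZMod p} (ht : t ≠ 0) : e ∣ levelCount e a t := by
  classical
  unfold levelCount
  rw [Finset.card_eq_sum_card_fiberwise (f := fun x : K => x ^ e) (t := Finset.univ)
    (by intro x _; simp)]
  refine Finset.dvd_sum fun y _ => ?_
  rw [Finset.filter_filter]
  by_cases h : Algebra.trace (ZMod p) K (a * y) = t
  · have hy : y ≠ 0 := by rintro rfl; simp at h; exact ht h.symm
    have : (Finset.univ.filter fun x : K =>
        Algebra.trace (ZMod p) K (a * x ^ e) = t ∧ x ^ e = y)
        = Finset.univ.filter fun x : K => x ^ e = y := by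
      ext x
      simp only [Finset.mem_filter, Finset.mem_univ, true_and, and_iff_right_iff_imp]
      rintro rfl; exact h
    rw [this]
    rcases card_filter_pow_eq he hy with h | h <;> simp [h]
  · have : (Finset.univ.filter fun x : K =>
        Algebra.trace (ZMod p) K (a * x ^ e) = t ∧ x ^ e = y) = ∅ := by
      ext x
      simp only [Finset.mem_filter, Finset.mem_univ, true_and, Finset.notMem_empty, iff_false]
      rintro ⟨h1, rfl⟩; exact h h1
    rw [this]; simp

lemma radicalCard_one (h2 : (2 : K) ≠ 0) {a : K} (ha : a ≠ 0) : radicalCard 1 a = 1 := by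
  classical
  unfold radicalCard
  rw [Finset.card_eq_one]
  refine ⟨0, ?_⟩
  ext z
  have : a ^ 1 * z ^ 1 ^ 2 + a * z = 2 * (a * z) := by ring
  simp only [Finset.mem_filter, Finset.mem_univ, true_and, Finset.mem_singleton, this]
  simp [h2, ha]

/-- Nonzero radical elements are the solutions of z^(q²-1) = -a/a^q; there are 0 or q²-1 of them. -/
lemma radicalCard_eq {q : ℕ} (hq : 1 < q) (hqK : q ^ 2 - 1 ∣ Fintype.card K - 1) {a : K}
    (ha : a ≠ 0) : radicalCard q a = 1 ∨ radicalCard q a = q ^ 2 := by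
  classical
  have h1 : 0 < q ^ 2 := by positivity
  have hcard : radicalCard q a =
      (Finset.univ.filter fun z : K => z ^ (q ^ 2 - 1) = -a / a ^ q).card + 1 := by
    have hzero : (0 : K) ∉ Finset.univ.filter fun z : K => z ^ (q ^ 2 - 1) = -a / a ^ q := by
      have : q ^ 2 - 1 ≠ 0 := by
        have : 1 < q ^ 2 := Nat.one_lt_pow (by norm_num) hq
        omega
      have h0 : -a / a ^ q ≠ 0 := div_ne_zero (neg_ne_zero.mpr ha) (pow_ne_zero _ ha)
      simp [zero_pow this, h0.symm]
    rw [← Finset.card_insert_of_notMem hzero]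
    unfold radicalCard
    congr 1
    ext z
    simp only [Finset.mem_filter, Finset.mem_univ, true_and, Finset.mem_insert]
    rcases eq_or_ne z 0 with rfl | hz
    · simp [zero_pow h1.ne']
    · simp only [hz, false_or]
      rw [eq_div_iff (pow_ne_zero _ ha)]
      have : a ^ q * z ^ q ^ 2 + a * z = (z ^ (q ^ 2 - 1) * a ^ q + a) * z := by
        conv_lhs => rw [← Nat.sub_add_cancel h1, pow_succ z]
        ring
      rw [this, mul_eq_zero, or_iff_left hz, add_eq_zero_iff_eq_neg]
  rw [hcard]
  rcases card_filter_pow_eq hqK (y := -a / a ^ q)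
    (div_ne_zero (neg_ne_zero.mpr ha) (pow_ne_zero _ ha)) with h | h <;> rw [h] <;> omega

end Powers

/-- A two-valued function on the nonzero elements with vanishing sum. -/
lemma card_of_two_values {p : ℕ} [Fact p.Prime] {K : Type*} [Field K] [Fintype K]
    [DecidableEq K] {m : ℕ} (hK : Fintype.card K = p ^ m) {f : K → ℤ}
    {u v : ℤ} (huv : u ≠ v) (hf : ∀ a, a ≠ 0 → f a = u ∨ f a = v)
    (hsum : ∑ a ∈ Finset.univ.filter (fun a : K => a ≠ 0), f a = 0) :
    ({a : K | a ≠ 0 ∧ f a = u}.ncard : ℤ) + {a : K | a ≠ 0 ∧ f a = v}.ncard = p ^ m - 1 ∧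
    ({a : K | a ≠ 0 ∧ f a = u}.ncard : ℤ) * u + {a : K | a ≠ 0 ∧ f a = v}.ncard * v = 0 := by
  have hc : ∀ w, {a : K | a ≠ 0 ∧ f a = w}.ncard =
      ((Finset.univ.filter (fun a : K => a ≠ 0)).filter fun a => f a = w).card := by
    intro w
    rw [← Set.ncard_coe_finset]
    congr 1; ext a; simp
  have hnot : ((Finset.univ.filter (fun a : K => a ≠ 0)).filter fun a => ¬ f a = u) =
      ((Finset.univ.filter (fun a : K => a ≠ 0)).filter fun a => f a = v) := by
    refine Finset.filter_congr fun a ha => ?_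
    have := hf a (Finset.mem_filter.mp ha).2
    constructor
    · exact this.resolve_left
    · intro h h'; exact huv (h'.symm.trans h)
  rw [hc, hc]
  constructor
  · have h := Finset.card_filter_add_card_filter_not
      (s := Finset.univ.filter (fun a : K => a ≠ 0)) (fun a => f a = u)
    have hcard : (Finset.univ.filter (fun a : K => a ≠ 0)).card = p ^ m - 1 := by
      rw [Finset.filter_ne', Finset.card_erase_of_mem (Finset.mem_univ _), Finset.card_univ, hK]
    rw [hnot, hcard] at h
    have h1 : 1 ≤ p ^ m := Nat.one_le_pow _ _ (Fact.out : p.Prime).pos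
    zify [h1] at h
    exact h
  · rw [← hsum, ← Finset.sum_filter_add_sum_filter_not _ (fun a => f a = u), hnot]
    congr 1
    · rw [Finset.sum_congr rfl fun a ha => (Finset.mem_filter.mp ha).2, Finset.sum_const,
        nsmul_eq_mul]
    · rw [Finset.sum_congr rfl fun a ha => (Finset.mem_filter.mp ha).2, Finset.sum_const,
        nsmul_eq_mul]

lemma two_ne_zero_of_odd_prime {p : ℕ} [Fact p.Prime] {K : Type*} [Field K] [Algebra (ZMod p) K]
    (hp : p ≠ 2) : (2 : K) ≠ 0 := by
  have : CharP K p := charP_of_injective_algebraMap (algebraMap (ZMod p) K).injective p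
  intro h
  have h5 : p ∣ 2 := (CharP.cast_eq_zero_iff K p 2).mp (by exact_mod_cast h)
  exact hp ((Nat.prime_dvd_prime_iff_eq Fact.out Nat.prime_two).mp h5)

/-! ### Exact level counts of the forms Tr(a x^e) -/

section Levels

variable {p : ℕ} [Fact p.Prime] {K : Type*} [Field K] [Fintype K] [Algebra (ZMod p) K]

lemma levelCount_eq_of_pow_divisor {m e : ℕ} (hK : Fintype.card K = p ^ m)
    (he : (p - 1) * e ∣ p ^ m - 1) (a : K) {t : ZMod p} (ht : t ≠ 0) :
    levelCount e a t = levelCount e a (1 : ZMod p) := by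
  obtain ⟨b, hb, hbt⟩ := exists_pow_eq_algebraMap (K := K) (by rw [hK]; exact he) ht
  rw [← levelCount_smul ht a 1, mul_one, ← hbt, levelCount_pow_mul hb]

lemma levelCount_zero_add {m e : ℕ} (hK : Fintype.card K = p ^ m)
    (he : (p - 1) * e ∣ p ^ m - 1) (a : K) :
    (levelCount e a (0 : ZMod p) : ℤ) + (p - 1) * levelCount e a (1 : ZMod p) = p ^ m := by
  have h := sum_levelCount (p := p) e a
  rw [← Finset.add_sum_erase _ _ (Finset.mem_univ (0 : ZMod p)),
    Finset.sum_congr rfl fun t ht => levelCount_eq_of_pow_divisor hK he a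
      (Finset.ne_of_mem_erase ht), Finset.sum_const, Finset.card_erase_of_mem (Finset.mem_univ _),
    Finset.card_univ, ZMod.card, hK, smul_eq_mul] at h
  have h1 : 1 ≤ p := (Fact.out : p.Prime).one_le
  have := congrArg (Nat.cast : ℕ → ℤ) h
  push_cast [Nat.cast_sub h1] at this
  exact this

/-- The deviation of the number of solutions of `Tr(a x^e) = 1` from its mean value `p^(m-1)`. -/
noncomputable def deviation (p m e : ℕ) {K : Type*} [Field K] [Fintype K] [Algebra (ZMod p) K]
    (a : K) : ℤ :=
  p ^ (m - 1) - levelCount e a (1 : ZMod p)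

lemma levelCount_ne_zero_eq {m e : ℕ} (hK : Fintype.card K = p ^ m)
    (he : (p - 1) * e ∣ p ^ m - 1) (a : K) {t : ZMod p} (ht : t ≠ 0) :
    (levelCount e a t : ℤ) = p ^ (m - 1) - deviation p m e a := by
  rw [levelCount_eq_of_pow_divisor hK he a ht, deviation]; ring

lemma levelCount_zero_eq {m e : ℕ} (hK : Fintype.card K = p ^ m) (hm : 0 < m)
    (he : (p - 1) * e ∣ p ^ m - 1) (a : K) :
    (levelCount e a (0 : ZMod p) : ℤ) = p ^ (m - 1) + (p - 1) * deviation p m e a := by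
  have h := levelCount_zero_add hK he a
  obtain ⟨r, rfl⟩ : ∃ r, m = r + 1 := ⟨m - 1, by omega⟩
  rw [deviation]
  simp only [Nat.add_sub_cancel] at *
  rw [pow_succ] at h
  linear_combination h

/-- With level 0 equal to p^(m-1) + (p-1)D and the others to p^(m-1) - D, the second moment is
p^(2m-1) + p(p-1)D². Compare with `sum_levelCount_sq` and cancel p-1. -/
lemma deviation_sq (hp : p ≠ 2) {m j : ℕ} (hK : Fintype.card K = p ^ m) (hm : 0 < m)
    (he : (p - 1) * (p ^ j + 1) ∣ p ^ m - 1) (a : K) :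
    (p : ℤ) * deviation p m (p ^ j + 1) a ^ 2 = radicalCard (p ^ j) a * p ^ (m - 1) := by
  have h := sum_levelCount_sq hp hK hm j a
  rw [← Finset.add_sum_erase _ _ (Finset.mem_univ (0 : ZMod p)),
    Finset.sum_congr rfl fun t ht => by
      rw [levelCount_ne_zero_eq hK he a (Finset.ne_of_mem_erase ht)],
    levelCount_zero_eq hK hm he,
    Finset.sum_const, Finset.card_erase_of_mem (Finset.mem_univ _), Finset.card_univ, ZMod.card,
    nsmul_eq_mul, Nat.cast_sub (Fact.out : p.Prime).one_le] at h
  obtain ⟨r, rfl⟩ : ∃ r, m = r + 1 := ⟨m - 1, by omega⟩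
  simp only [Nat.add_sub_cancel, Nat.cast_one] at *
  rw [pow_succ] at h
  have h1 : (p : ℤ) - 1 ≠ 0 := by
    have := (Fact.out : p.Prime).two_le
    omega
  apply mul_left_cancel₀ h1
  linear_combination h

lemma sum_deviation [DecidableEq K] {m e : ℕ} (hK : Fintype.card K = p ^ m) (hm : 0 < m)
    (he : e ≠ 0) :
    ∑ a ∈ Finset.univ.filter (fun a : K => a ≠ 0), deviation p m e a = 0 := by
  have h := congrArg (Nat.cast : ℕ → ℤ) (sum_levelCount_ne_zero hK hm he (1 : ZMod p))
  have hc : (Finset.univ.filter (fun a : K => a ≠ 0)).card = p ^ m - 1 := by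
    rw [Finset.filter_ne', Finset.card_erase_of_mem (Finset.mem_univ _), Finset.card_univ, hK]
  push_cast at h
  simp only [deviation]
  rw [Finset.sum_sub_distrib, h, Finset.sum_const, hc, nsmul_eq_mul]
  ring

lemma deviation_two_eq (hp : p ≠ 2) {r : ℕ} (hr : 0 < r) (hK : Fintype.card K = p ^ (2 * r))
    (he : (p - 1) * 2 ∣ p ^ (2 * r) - 1) {a : K} (ha : a ≠ 0) :
    deviation p (2 * r) 2 a = p ^ (r - 1) ∨ deviation p (2 * r) 2 a = -p ^ (r - 1) := by
  -- The exponent 2 is p^0 + 1; here the radical is trivial.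
  have h := deviation_sq (j := 0) hp hK (by omega) he a
  rw [pow_zero, radicalCard_one (two_ne_zero_of_odd_prime hp) ha] at h
  obtain ⟨s, rfl⟩ : ∃ s, r = s + 1 := ⟨r - 1, by omega⟩
  rw [show 2 * (s + 1) - 1 = s * 2 + 1 by omega, pow_succ _ (s * 2), pow_mul _ s] at h
  have hp0 : (p : ℤ) ≠ 0 := by exact_mod_cast (Fact.out : p.Prime).ne_zero
  rw [← sq_eq_sq_iff_eq_or_eq_neg]
  apply mul_left_cancel₀ hp0
  simp only [Nat.add_sub_cancel]
  push_cast at h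
  linear_combination h

/-- Modulo q+1 one has q ≡ -1, and q+1 > 2 separates 1 from -1. -/
lemma eq_neg_one_pow_of_dvd {q : ℤ} (hq : 1 < q) {i : ℕ} {σ : ℤ} (hσ : σ = 1 ∨ σ = -1)
    (h : q + 1 ∣ σ * q ^ i - 1) : σ = (-1) ^ i := by
  have h1 : q + 1 ∣ q ^ i - (-1) ^ i := by simpa using sub_dvd_pow_sub_pow q (-1) i
  have h2 : q + 1 ∣ σ * (-1) ^ i - 1 := by
    have := h.sub (h1.mul_left σ)
    have e : σ * q ^ i - 1 - σ * (q ^ i - (-1) ^ i) = σ * (-1) ^ i - 1 := by ring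
    rwa [e] at this
  rcases hσ with rfl | rfl <;> rcases neg_one_pow_eq_or ℤ i with hi | hi <;> rw [hi] at h2 ⊢ <;>
    norm_num at h2 ⊢
  · have := Int.le_of_dvd (by norm_num) h2; omega
  · have := Int.le_of_dvd (by norm_num) h2; omega

/-- The two absolute values come from the two radical sizes. For the sign, pD = p^m - pN with N the
count at level 1; q+1 (where q = p^d) divides N and p^m-1, so pD ≡ 1 mod q+1. Since pD is ±q^s or
±q^(s+1), the sign is (-1)^s or (-1)^(s+1). -/
lemma deviation_eq (hp : p ≠ 2) {d s : ℕ} (hd : 0 < d) (hs : 0 < s)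
    (hK : Fintype.card K = p ^ (2 * (d * s))) {a : K} (ha : a ≠ 0)
    (he : (p - 1) * (p ^ d + 1) ∣ p ^ (2 * (d * s)) - 1) :
    deviation p (2 * (d * s)) (p ^ d + 1) a = (-1) ^ s * p ^ (d * s - 1) ∨
      deviation p (2 * (d * s)) (p ^ d + 1) a = -(-1) ^ s * p ^ (d * s - 1 + d) := by
  have hp1 : 1 < p := (Fact.out : p.Prime).one_lt
  have hp0 : (p : ℤ) ≠ 0 := by exact_mod_cast (Fact.out : p.Prime).ne_zero
  have hds : 0 < d * s := Nat.mul_pos hd hs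
  have hq : 1 < p ^ d := Nat.one_lt_pow hd.ne' hp1
  have hdvd : (p ^ d) ^ 2 - 1 ∣ Fintype.card K - 1 := by
    rw [hK, ← pow_mul, show 2 * (d * s) = d * 2 * s by ring, pow_mul p (d * 2)]
    exact Nat.sub_one_dvd_pow_sub_one _ _
  have hsq := deviation_sq hp hK (by omega) he a
  have hcong : ((p : ℤ) ^ d + 1) ∣ p * deviation p (2 * (d * s)) (p ^ d + 1) a - 1 := by
    have he' : p ^ d + 1 ∣ p ^ (2 * (d * s)) - 1 := (dvd_mul_left _ _).trans he
    have h1 := dvd_levelCount (p := p) (e := p ^ d + 1) (by rw [hK]; exact he') a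
      (one_ne_zero : (1 : ZMod p) ≠ 0)
    have h1' : ((p : ℤ) ^ d + 1) ∣ levelCount (p ^ d + 1) a (1 : ZMod p) := by exact_mod_cast h1
    have h2 : ((p : ℤ) ^ d + 1) ∣ p ^ (2 * (d * s)) - 1 := by
      have := Int.natCast_dvd_natCast.mpr he'
      rw [Nat.cast_sub (Nat.one_le_pow _ _ (by omega))] at this
      exact_mod_cast this
    have h3 := h2.sub (h1'.mul_left p)
    have e : (p : ℤ) * deviation p (2 * (d * s)) (p ^ d + 1) a - 1 = p ^ (2 * (d * s)) - 1
        - p * levelCount (p ^ d + 1) a (1 : ZMod p) := by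
      rw [deviation, mul_sub, ← pow_succ', Nat.sub_add_cancel (by omega)]
      ring
    rwa [e]
  set D := deviation p (2 * (d * s)) (p ^ d + 1) a
  have hQ : (p : ℤ) * p ^ (d * s - 1) = (p ^ d) ^ s := by
    rw [← pow_succ', Nat.sub_add_cancel (by omega), pow_mul]
  have hpow : (p : ℤ) ^ (2 * (d * s) - 1) = p * (p ^ (d * s - 1)) ^ 2 := by
    rw [← pow_mul, ← pow_succ']; congr 1; omega
  rw [hpow] at hsq
  have hq' : 1 < (p : ℤ) ^ d := by exact_mod_cast hq
  rcases radicalCard_eq hq hdvd ha with hR | hR <;> rw [hR] at hsq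
  · left
    have : D ^ 2 = ((p : ℤ) ^ (d * s - 1)) ^ 2 := by
      apply mul_left_cancel₀ hp0; rw [hsq]; push_cast; ring
    obtain ⟨σ, hσ, hD⟩ : ∃ σ : ℤ, (σ = 1 ∨ σ = -1) ∧ D = σ * p ^ (d * s - 1) := by
      rcases sq_eq_sq_iff_eq_or_eq_neg.mp this with h | h
      · exact ⟨1, by simp, by simpa using h⟩
      · exact ⟨-1, by simp, by simpa using h⟩
    rw [hD, ← eq_neg_one_pow_of_dvd hq' (i := s) hσ]
    convert hcong using 1
    rw [hD, ← hQ]; ring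
  · right
    have : D ^ 2 = ((p : ℤ) ^ (d * s - 1 + d)) ^ 2 := by
      apply mul_left_cancel₀ hp0; rw [hsq, pow_add]; push_cast; ring
    obtain ⟨σ, hσ, hD⟩ : ∃ σ : ℤ, (σ = 1 ∨ σ = -1) ∧ D = σ * p ^ (d * s - 1 + d) := by
      rcases sq_eq_sq_iff_eq_or_eq_neg.mp this with h | h
      · exact ⟨1, by simp, by simpa using h⟩
      · exact ⟨-1, by simp, by simpa using h⟩
    have h := eq_neg_one_pow_of_dvd hq' (i := s + 1) hσ (by
      convert hcong using 1
      rw [hD, pow_succ _ s, ← hQ, pow_add]; ring)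
    rw [hD, h, pow_succ]; ring

lemma isSquare_mul_of_not_isSquare {x y : K} (hx : ¬ IsSquare x)
    (hy : ¬ IsSquare y) : IsSquare (x * y) := by
  classical
  have hx0 : x ≠ 0 := by rintro rfl; exact hx (IsSquare.zero)
  have hy0 : y ≠ 0 := by rintro rfl; exact hy (IsSquare.zero)
  rw [← quadraticChar_one_iff_isSquare (mul_ne_zero hx0 hy0), map_mul,
    quadraticChar_neg_one_iff_not_isSquare.mpr hx, quadraticChar_neg_one_iff_not_isSquare.mpr hy]
  norm_num

/-- There are only two square classes, and b, γb represent both. Hence the sum is the same for every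
nonzero b, and its value is found by averaging over b. -/
lemma levelCount_two_add {m : ℕ} (hK : Fintype.card K = p ^ m) (hm : 0 < m) {γ : K}
    (hγ : ¬ IsSquare γ) {a : K} (ha : a ≠ 0) (t : ZMod p) :
    levelCount 2 a t + levelCount 2 (γ * a) t = 2 * p ^ (m - 1) := by
  classical
  have hγ0 : γ ≠ 0 := by rintro rfl; exact hγ IsSquare.zero
  have hconst : ∀ b : K, b ≠ 0 → levelCount 2 b t + levelCount 2 (γ * b) t =
      levelCount 2 a t + levelCount 2 (γ * a) t := by
    intro b hb
    by_cases h : IsSquare (b / a)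
    · obtain ⟨c, hc⟩ := h
      have hc0 : c ≠ 0 := by
        rintro rfl
        simp [ha, hb] at hc
      have hb' : b = c ^ 2 * a := by rw [sq, ← hc, div_mul_cancel₀ _ ha]
      rw [hb', levelCount_pow_mul hc0, mul_left_comm, levelCount_pow_mul hc0]
    · obtain ⟨c, hc⟩ := isSquare_mul_of_not_isSquare hγ h
      have hc0 : c ≠ 0 := by
        rintro rfl
        simp [ha, hb, hγ0] at hc
      have h1 : γ * b = c ^ 2 * a := by rw [sq, ← hc]; field_simp
      have h2 : b = (c / γ) ^ 2 * (γ * a) := by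
        field_simp
        linear_combination h1
      rw [h1, levelCount_pow_mul hc0]
      conv_lhs => rw [h2, levelCount_pow_mul (div_ne_zero hc0 hγ0)]
      ring
  have hs := sum_levelCount_ne_zero hK hm two_ne_zero t
  have hs' : ∑ b ∈ Finset.univ.filter (fun b : K => b ≠ 0), levelCount 2 (γ * b) t
      = (p ^ m - 1) * p ^ (m - 1) := by
    rw [← hs]
    refine Finset.sum_equiv (Equiv.mulLeft₀ γ hγ0) ?_ ?_
    · intro b; simp [hγ0]
    · intro b _; rfl
  have hadd : ∑ b ∈ Finset.univ.filter (fun b : K => b ≠ 0),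
      (levelCount 2 b t + levelCount 2 (γ * b) t) = (p ^ m - 1) * (2 * p ^ (m - 1)) := by
    rw [Finset.sum_add_distrib, hs, hs']; ring
  rw [Finset.sum_congr rfl fun b hb => hconst b (Finset.mem_filter.mp hb).2, Finset.sum_const,
    Finset.filter_ne', Finset.card_erase_of_mem (Finset.mem_univ _), Finset.card_univ, hK,
    smul_eq_mul] at hadd
  refine Nat.eq_of_mul_eq_mul_left ?_ hadd
  have : 1 < p ^ m := Nat.one_lt_pow hm.ne' (Fact.out : p.Prime).one_lt
  omega

/-- If c were a square in K, then c^((p^m-1)/2) = 1. But this exponent is (p-1)/2 times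
1+p+⋯+p^(m-1), a sum of m odd numbers and so odd, and Euler's criterion gives -1. -/
lemma exists_not_isSquare_algebraMap (hp : p ≠ 2) {m : ℕ} (hK : Fintype.card K = p ^ m)
    (hm : Odd m) : ∃ c : ZMod p, c ≠ 0 ∧ ¬ IsSquare (algebraMap (ZMod p) K c) := by
  have hpo : Odd p := (Fact.out : p.Prime).odd_of_ne_two hp
  obtain ⟨c, hc⟩ := FiniteField.exists_nonsquare (F := ZMod p) (by rwa [ZMod.ringChar_zmod_n])
  have hc0 : c ≠ 0 := by rintro rfl; exact hc IsSquare.zero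
  refine ⟨c, hc0, fun ⟨b, hb⟩ => ?_⟩
  have hb0 : b ≠ 0 := by
    rintro rfl
    simp [hc0] at hb
  have hpow : c ^ ((p ^ m - 1) / 2) = 1 := by
    apply (algebraMap (ZMod p) K).injective
    rw [map_pow, hb, ← sq, ← pow_mul, map_one]
    have h2 : 2 ∣ p ^ m - 1 := (hpo.pow.tsub_odd odd_one).two_dvd
    rw [Nat.mul_div_cancel' h2, ← hK]
    exact FiniteField.pow_card_sub_one_eq_one b hb0
  have hneg : c ^ (p / 2) = -1 := (ZMod.pow_div_two_eq_neg_one_or_one p hc0).resolve_left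
    fun h => hc ((ZMod.euler_criterion p hc0).mpr h)
  have hfac : (p ^ m - 1) / 2 = (p / 2) * ∑ i ∈ Finset.range m, p ^ i := by
    have h1 := Nat.geomSum_eq (Fact.out : p.Prime).two_le m
    have h2 : p - 1 = 2 * (p / 2) := by obtain ⟨i, rfl⟩ := hpo; omega
    have h3 : (∑ i ∈ Finset.range m, p ^ i) * (p - 1) = p ^ m - 1 := by
      rw [h1]; exact Nat.div_mul_cancel (Nat.sub_one_dvd_pow_sub_one _ _)
    rw [← h3, h2, ← mul_assoc, mul_comm _ 2, mul_assoc]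
    simp [mul_comm]
  have hodd : Odd (∑ i ∈ Finset.range m, p ^ i) := by
    rw [Finset.odd_sum_iff_odd_card_odd]
    rw [Finset.filter_true_of_mem (fun i _ => hpo.pow), Finset.card_range]
    exact hm
  rw [hfac, pow_mul, hneg, hodd.neg_one_pow] at hpow
  have := two_ne_zero_of_odd_prime (K := ZMod p) hp
  apply this
  linear_combination -hpow

/-- For a nonsquare γ taken from F_p, scaling by γ preserves level 0, so the two summands of
`levelCount_two_add` agree. -/
lemma levelCount_two_zero_of_odd (hp : p ≠ 2) {m : ℕ} (hK : Fintype.card K = p ^ m)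
    (hm : Odd m) {a : K} (ha : a ≠ 0) : levelCount 2 a (0 : ZMod p) = p ^ (m - 1) := by
  obtain ⟨c, hc0, hc⟩ := exists_not_isSquare_algebraMap (K := K) hp hK hm
  have h1 := levelCount_two_add hK hm.pos hc ha 0
  have h2 := levelCount_smul (e := 2) hc0 a 0
  rw [mul_zero] at h2
  omega

/-- The deviation at t ≠ 0 equals ± that at 1, according to whether t is a square in K, and it
vanishes at 0. The second moment then determines its square. -/
lemma levelCount_two_of_odd (hp : p ≠ 2) {m : ℕ} (hK : Fintype.card K = p ^ m)
    (hm : Odd m) {a : K} (ha : a ≠ 0) {t : ZMod p} (ht : t ≠ 0) :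
    (levelCount 2 a t : ℤ) - p ^ (m - 1) = p ^ ((m - 1) / 2) ∨
      (levelCount 2 a t : ℤ) - p ^ (m - 1) = -p ^ ((m - 1) / 2) := by
  set D : ZMod p → ℤ := fun t => (levelCount 2 a t : ℤ) - p ^ (m - 1) with hD
  have hsame : ∀ t : ZMod p, t ≠ 0 → D t ^ 2 = D 1 ^ 2 := by
    intro t ht
    have h := levelCount_smul (e := 2) ht a 1
    rw [mul_one] at h
    by_cases hs : IsSquare (algebraMap (ZMod p) K t)
    · obtain ⟨b, hb⟩ := hs
      have hb0 : b ≠ 0 := by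
        rintro rfl
        simp [ht] at hb
      rw [hb, ← sq, levelCount_pow_mul hb0] at h
      simp only [hD, h]
    · have h2 := congrArg (Nat.cast : ℕ → ℤ) (levelCount_two_add hK hm.pos hs ha t)
      rw [h] at h2
      push_cast at h2
      have : D t = - D 1 := by
        simp only [hD]
        linear_combination h2
      rw [this, neg_sq]
  have hsum : ∑ t : ZMod p, D t = 0 := by
    have h := congrArg (Nat.cast : ℕ → ℤ) (sum_levelCount (p := p) 2 a)
    push_cast [hK] at h
    simp only [hD, Finset.sum_sub_distrib, h, Finset.sum_const, Finset.card_univ, ZMod.card,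
      nsmul_eq_mul]
    rw [← pow_succ', Nat.sub_add_cancel hm.pos, sub_self]
  have hzero : D 0 = 0 := by
    simp only [hD, levelCount_two_zero_of_odd hp hK hm ha]
    push_cast; ring
  have hsq : ∑ t : ZMod p, D t ^ 2 = (p - 1) * D 1 ^ 2 := by
    rw [← Finset.add_sum_erase _ _ (Finset.mem_univ (0 : ZMod p)), hzero,
      Finset.sum_congr rfl fun t ht => hsame t (Finset.ne_of_mem_erase ht), Finset.sum_const,
      Finset.card_erase_of_mem (Finset.mem_univ _), Finset.card_univ, ZMod.card, nsmul_eq_mul,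
      Nat.cast_sub (Fact.out : p.Prime).one_le]
    push_cast; ring
  have h2 := sum_levelCount_sq hp hK hm.pos 0 a
  rw [pow_zero, radicalCard_one (two_ne_zero_of_odd_prime hp) ha] at h2
  have h3 : ∑ t : ZMod p, (levelCount (1 + 1) a t : ℤ) ^ 2 =
      ∑ t : ZMod p, D t ^ 2 + 2 * p ^ (m - 1) * ∑ t : ZMod p, D t + p * (p ^ (m - 1)) ^ 2 := by
    rw [Finset.mul_sum, ← Finset.sum_add_distrib]
    have : (p : ℤ) * (p ^ (m - 1)) ^ 2 = ∑ t : ZMod p, ((p : ℤ) ^ (m - 1)) ^ 2 := by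
      rw [Finset.sum_const, Finset.card_univ, ZMod.card, nsmul_eq_mul]
    rw [this, ← Finset.sum_add_distrib]
    refine Finset.sum_congr rfl fun t _ => ?_
    simp only [hD]; ring
  rw [hsum, hsq] at h3
  rw [← sq_eq_sq_iff_eq_or_eq_neg]
  refine (hsame t ht).trans ?_
  obtain ⟨r, rfl⟩ := hm
  have hp1 : (p : ℤ) - 1 ≠ 0 := by
    have := (Fact.out : p.Prime).two_le
    omega
  apply mul_left_cancel₀ hp1
  rw [h3] at h2
  simp only [Nat.add_sub_cancel] at h2 ⊢
  rw [show 2 * r / 2 = r by omega]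
  rw [pow_succ, mul_comm 2 r, pow_mul] at h2
  push_cast at h2
  linear_combination h2

lemma card_levelCount_two_of_odd [DecidableEq K] (hp : p ≠ 2) {m : ℕ}
    (hK : Fintype.card K = p ^ m) (hm : Odd m) {t : ZMod p} (ht : t ≠ 0) :
    {a : K | a ≠ 0 ∧ (levelCount 2 a t : ℤ) - p ^ (m - 1) = p ^ ((m - 1) / 2)}.ncard
      = (p ^ m - 1) / 2 ∧
    {a : K | a ≠ 0 ∧ (levelCount 2 a t : ℤ) - p ^ (m - 1) = -p ^ ((m - 1) / 2)}.ncard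
      = (p ^ m - 1) / 2 := by
  have hpos : (0 : ℤ) < p ^ ((m - 1) / 2) :=
    pow_pos (by exact_mod_cast (Fact.out : p.Prime).pos) _
  have h := congrArg (Nat.cast : ℕ → ℤ) (sum_levelCount_ne_zero (K := K) hK hm.pos two_ne_zero t)
  have h1 : 1 ≤ p ^ m := Nat.one_le_pow _ _ (Fact.out : p.Prime).pos
  have hc : (Finset.univ.filter (fun a : K => a ≠ 0)).card = p ^ m - 1 := by
    rw [Finset.filter_ne', Finset.card_erase_of_mem (Finset.mem_univ _), Finset.card_univ, hK]
  obtain ⟨ha, hb⟩ := card_of_two_values hK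
    (f := fun a => (levelCount 2 a t : ℤ) - p ^ (m - 1)) (by omega)
    (fun a ha => levelCount_two_of_odd hp hK hm ha ht) (by
      push_cast at h
      rw [Finset.sum_sub_distrib, h, Finset.sum_const, hc, nsmul_eq_mul]
      ring)
  rw [mul_neg, ← sub_eq_add_neg, ← sub_mul] at hb
  have hb' := (mul_eq_zero.mp hb).resolve_right hpos.ne'
  have : ((p ^ m - 1 : ℕ) : ℤ) = p ^ m - 1 := by push_cast [Nat.cast_sub h1]; ring
  rw [← this] at ha
  omega

end Levels

/-! ### Codes given by a parity-check polynomial -/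

section ParityCheck

variable {F : Type*} [Field F] {n : ℕ}

lemma wordPoly_apply (c : Fin n → F) :
    wordPoly F n c = ∑ i : Fin n, monomial (i : ℕ) (c i) := by
  simp [wordPoly]

lemma coeff_wordPoly (c : Fin n → F) (i : Fin n) : (wordPoly F n c).coeff i = c i := by
  rw [wordPoly_apply, finsetSum_coeff, Finset.sum_eq_single i]
  · simp
  · intro j _ hj
    rw [coeff_monomial, if_neg]
    exact fun h => hj (Fin.ext h)
  · simp

lemma degree_wordPoly_lt (c : Fin n → F) : (wordPoly F n c).degree < n := by
  rw [wordPoly_apply]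
  refine (degree_sum_le _ _).trans_lt ?_
  rw [Finset.sup_lt_iff (by exact_mod_cast WithBot.bot_lt_coe n)]
  intro i _
  exact (degree_monomial_le _ _).trans_lt (by exact_mod_cast i.2)

/-- The generator polynomial divides x^n-1, so divisibility in the quotient lifts to polynomials. -/
lemma mem_codeOfParityCheck (hn : 0 < n) {h : F[X]} (hh : h ∣ X ^ n - 1) (c : Fin n → F) :
    c ∈ codeOfParityCheck n h ↔ (X ^ n - 1) / h ∣ wordPoly F n c := by
  have hg : (X ^ n - 1) / h ∣ (X ^ n - 1 : F[X]) :=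
    ⟨h, by
      rw [mul_comm]
      exact (EuclideanDomain.mul_div_cancel'
        (ne_zero_of_dvd_ne_zero (X_pow_sub_C_ne_zero hn (1 : F)) (by rwa [C_1])) hh).symm⟩
  unfold codeOfParityCheck
  simp only [Submodule.mem_comap, Submodule.restrictScalars_mem, wordClass, LinearMap.comp_apply,
    AlgHom.toLinearMap_apply, Ideal.Quotient.mkₐ_eq_mk, Ideal.mem_span_singleton]
  constructor
  · rintro ⟨r, hr⟩
    obtain ⟨r, rfl⟩ := Ideal.Quotient.mk_surjective r
    rw [← map_mul, Ideal.Quotient.eq, lengthIdeal, Ideal.mem_span_singleton] at hr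
    exact (dvd_sub_left (dvd_mul_right _ r)).mp (hg.trans hr)
  · exact fun hd => map_dvd _ hd

/-- Every codeword is g·f with deg f < deg h. -/
lemma finrank_codeOfParityCheck_le (hn : 0 < n) {h : F[X]} (hh : h ∣ X ^ n - 1) :
    Module.finrank F (codeOfParityCheck n h) ≤ h.natDegree := by
  have hX : (X ^ n - 1 : F[X]) ≠ 0 := X_pow_sub_C_ne_zero hn 1
  have h0 : h ≠ 0 := ne_zero_of_dvd_ne_zero hX hh
  set g := (X ^ n - 1) / h with hg
  have hgh : g * h = X ^ n - 1 := by
    rw [mul_comm]; exact EuclideanDomain.mul_div_cancel' h0 hh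
  have hg0 : g ≠ 0 := by rintro h1; rw [h1, zero_mul] at hgh; exact hX hgh.symm
  have hdeg : g.natDegree + h.natDegree = n := by
    rw [← natDegree_mul hg0 h0, hgh]
    exact natDegree_X_pow_sub_C (r := (1 : F))
  let L : degreeLT F h.natDegree →ₗ[F] (Fin n → F) :=
    (LinearMap.pi fun i : Fin n => lcoeff F (i : ℕ)) ∘ₗ (LinearMap.mulLeft F g) ∘ₗ
      (degreeLT F h.natDegree).subtype
  have hle : codeOfParityCheck n h ≤ LinearMap.range L := by
    intro c hc
    obtain ⟨f, hf⟩ := (mem_codeOfParityCheck hn hh c).mp hc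
    rw [← hg] at hf
    have hf' : f ∈ degreeLT F h.natDegree := by
      rw [mem_degreeLT]
      rcases eq_or_ne f 0 with rfl | hf0
      · simp
      · have := degree_wordPoly_lt c
        rw [hf, degree_eq_natDegree (mul_ne_zero hg0 hf0), natDegree_mul hg0 hf0] at this
        have : g.natDegree + f.natDegree < n := by exact_mod_cast this
        rw [degree_eq_natDegree hf0]
        exact_mod_cast (by omega : f.natDegree < h.natDegree)
    refine ⟨⟨f, hf'⟩, ?_⟩
    ext i
    simp [L, ← hf, coeff_wordPoly]
  have : Module.Finite F (degreeLT F h.natDegree) :=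
    Module.Finite.equiv (degreeLTEquiv F h.natDegree).symm
  calc Module.finrank F (codeOfParityCheck n h) ≤ Module.finrank F (LinearMap.range L) :=
        Submodule.finrank_mono hle
    _ ≤ Module.finrank F (degreeLT F h.natDegree) := LinearMap.finrank_range_le L
    _ = h.natDegree := by
        rw [(degreeLTEquiv F h.natDegree).finrank_eq, Module.finrank_fin_fun]

end ParityCheck

/-! ### The trace description of the code -/

section TraceWord

variable {p : ℕ} {K : Type*} [Field K] [Algebra (ZMod p) K]

/-- The words `(Tr(a θ^i) + b)_i`. -/
noncomputable def traceWord (p : ℕ) {K : Type*} [Field K] [Algebra (ZMod p) K] (n : ℕ) (θ : K) :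
    (K × ZMod p) →ₗ[ZMod p] (Fin n → ZMod p) :=
  LinearMap.pi fun i =>
    Algebra.trace (ZMod p) K ∘ₗ LinearMap.mulRight (ZMod p) (θ ^ (i : ℕ)) ∘ₗ LinearMap.fst _ _ _ +
      LinearMap.snd _ _ _

@[simp]
lemma traceWord_apply (n : ℕ) (θ : K) (x : K × ZMod p) (i : Fin n) :
    traceWord p n θ x i = Algebra.trace (ZMod p) K (x.1 * θ ^ (i : ℕ)) + x.2 := rfl

/-- The sum is geometric in θX and becomes (θX)^n - 1 = X^n - 1 after multiplication by θX - 1, a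
factor of h up to a constant. -/
lemma X_pow_sub_one_dvd_geometric {L : Type*} [Field L] {n : ℕ} {θ : L} (hθ : θ ≠ 0)
    (hn : θ ^ n = 1) (a : L) {h : L[X]} (hh : h.IsRoot θ⁻¹) :
    X ^ n - 1 ∣ h * ∑ i : Fin n, monomial (i : ℕ) (a * θ ^ (i : ℕ)) := by
  obtain ⟨r, rfl⟩ := dvd_iff_isRoot.mpr hh
  have h1 : ∑ i : Fin n, monomial (i : ℕ) (a * θ ^ (i : ℕ)) =
      C a * ∑ i ∈ Finset.range n, (C θ * X) ^ i := by
    rw [Fin.sum_univ_eq_sum_range (fun i => monomial i (a * θ ^ i)) n, Finset.mul_sum]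
    refine Finset.sum_congr rfl fun i _ => ?_
    rw [mul_pow, ← C_pow, ← mul_assoc, ← C_mul, C_mul_X_pow_eq_monomial]
  have h2 : (X - C θ⁻¹ : L[X]) = C θ⁻¹ * (C θ * X - 1) := by
    rw [mul_sub, ← mul_assoc, ← C_mul, inv_mul_cancel₀ hθ]; simp
  refine ⟨C θ⁻¹ * C a * r, ?_⟩
  have h3 := mul_geom_sum (C θ * X : L[X]) n
  rw [mul_pow, ← C_pow, hn, C_1, one_mul] at h3
  rw [h1, h2, ← h3]
  ring

variable [Fact p.Prime] [Fintype K]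

/-- Over K the trace splits the word into Frobenius conjugates of a geometric word. Frobenius fixes
h and X^n-1, so the divisibility passes to each conjugate. -/
lemma X_pow_sub_one_dvd_mul_wordPoly_trace {n : ℕ} {θ : K} (hθ : θ ≠ 0) (hn : θ ^ n = 1) (a : K)
    {h : (ZMod p)[X]} (hh : aeval θ⁻¹ h = 0) :
    X ^ n - 1 ∣ h * wordPoly (ZMod p) n (fun i => Algebra.trace (ZMod p) K (a * θ ^ (i : ℕ))) := by
  have : CharP K p := charP_of_injective_algebraMap (algebraMap (ZMod p) K).injective p
  rw [← map_dvd_map' (algebraMap (ZMod p) K), Polynomial.map_mul]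
  have key : (wordPoly (ZMod p) n (fun i => Algebra.trace (ZMod p) K (a * θ ^ (i : ℕ)))).map
      (algebraMap (ZMod p) K) = ∑ j ∈ Finset.range (Module.finrank (ZMod p) K),
        (∑ i : Fin n, monomial (i : ℕ) (a * θ ^ (i : ℕ))).map (iterateFrobenius K p j) := by
    simp_rw [wordPoly_apply, Polynomial.map_sum, map_monomial]
    rw [Finset.sum_comm]
    refine Finset.sum_congr rfl fun i _ => ?_
    rw [FiniteField.algebraMap_trace_eq_sum_pow, Nat.card_zmod, map_sum]
    rfl
  rw [key, Finset.mul_sum]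
  refine Finset.dvd_sum fun j _ => ?_
  have hfix : (iterateFrobenius K p j).comp (algebraMap (ZMod p) K) = algebraMap (ZMod p) K :=
    RingHom.ext_zmod _ _
  have h1 := Polynomial.map_dvd (iterateFrobenius K p j)
    (X_pow_sub_one_dvd_geometric hθ hn a (h := h.map (algebraMap (ZMod p) K))
      (by rwa [IsRoot, eval_map_algebraMap]))
  rw [Polynomial.map_mul, Polynomial.map_map, hfix] at h1
  simpa using h1

lemma range_traceWord_le {n : ℕ} {θ : K} (hn0 : 0 < n) (hθ : θ ≠ 0) (hn : θ ^ n = 1)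
    (hh : (X - 1) * minpoly (ZMod p) θ⁻¹ ∣ (X ^ n - 1 : (ZMod p)[X])) :
    LinearMap.range (traceWord p n θ) ≤
      codeOfParityCheck n ((X - 1) * minpoly (ZMod p) θ⁻¹) := by
  rintro _ ⟨⟨a, b⟩, rfl⟩
  rw [mem_codeOfParityCheck hn0 hh]
  set h := (X - 1) * minpoly (ZMod p) θ⁻¹
  have hX : (X ^ n - 1 : (ZMod p)[X]) ≠ 0 := X_pow_sub_C_ne_zero hn0 1
  have h0 : h ≠ 0 := ne_zero_of_dvd_ne_zero hX hh
  have hgh : h * ((X ^ n - 1) / h) = X ^ n - 1 := EuclideanDomain.mul_div_cancel' h0 hh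
  have hsplit : traceWord p n θ (a, b) = (fun i : Fin n =>
      Algebra.trace (ZMod p) K (a * θ ^ (i : ℕ))) + fun i : Fin n => b * 1 ^ (i : ℕ) := by
    ext i; simp
  rw [← mul_dvd_mul_iff_left h0, hgh, hsplit, map_add, mul_add]
  refine dvd_add (X_pow_sub_one_dvd_mul_wordPoly_trace hθ hn a ?_) ?_
  · simp [h]
  · rw [wordPoly_apply]
    exact X_pow_sub_one_dvd_geometric one_ne_zero (one_pow n) b (by simp [h])

/-- The range has dimension m+1 by injectivity, and the code has at most this dimension because the
minimal polynomial has degree at most m. Thus the exact degree of the minimal polynomial need not be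
computed. -/
lemma codeOfParityCheck_eq_range {m n : ℕ} {θ : K} (hK : Fintype.card K = p ^ m) (hn0 : 0 < n)
    (hθ : θ ≠ 0) (hn : θ ^ n = 1)
    (hh : (X - 1) * minpoly (ZMod p) θ⁻¹ ∣ (X ^ n - 1 : (ZMod p)[X]))
    (hinj : Function.Injective (traceWord p n θ)) :
    codeOfParityCheck n ((X - 1) * minpoly (ZMod p) θ⁻¹) = LinearMap.range (traceWord p n θ) ∧
      Module.finrank (ZMod p) (LinearMap.range (traceWord p n θ)) = m + 1 := by
  have hfr : Module.finrank (ZMod p) K = m := by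
    have := Module.card_eq_pow_finrank (K := ZMod p) (V := K)
    rw [hK, ZMod.card] at this
    exact (Nat.pow_right_injective (Fact.out : p.Prime).two_le this).symm
  have hdim : Module.finrank (ZMod p) (LinearMap.range (traceWord p n θ)) = m + 1 := by
    rw [LinearMap.finrank_range_of_inj hinj, Module.finrank_prod, hfr, Module.finrank_self]
  refine ⟨(Submodule.eq_of_le_of_finrank_le (range_traceWord_le hn0 hθ hn hh) ?_).symm, hdim⟩
  rw [hdim]
  refine (finrank_codeOfParityCheck_le hn0 hh).trans (natDegree_mul_le.trans ?_)
  have h1 : (X - 1 : (ZMod p)[X]).natDegree = 1 := natDegree_X_sub_C 1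
  have h2 := minpoly.natDegree_le (A := ZMod p) θ⁻¹
  omega

end TraceWord

/-! ### Cyclicity, Hamming weights and weight tables -/

lemma isCyclicCode_range_traceWord {p : ℕ} [Fact p.Prime] {K : Type*} [Field K]
    [Algebra (ZMod p) K] {n : ℕ} {θ : K} (hθ : θ ≠ 0) (hn : θ ^ n = 1) :
    IsCyclicCode (LinearMap.range (traceWord p n θ)) := by
  rintro _ ⟨⟨a, b⟩, rfl⟩
  -- A shift of the word multiplies a by θ⁻¹; the wrap-around uses θ^n = 1.
  refine ⟨(a * θ⁻¹, b), ?_⟩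
  ext i
  obtain ⟨j, rfl⟩ := (finRotate n).surjective i
  rw [Equiv.symm_apply_apply, traceWord_apply, traceWord_apply]
  congr 2
  have : θ ^ (finRotate n j : ℕ) = θ * θ ^ (j : ℕ) := by
    cases n with
    | zero => exact j.elim0
    | succ n =>
      rw [coe_finRotate, ← pow_succ']
      split_ifs with h
      · rw [h, Fin.val_last, hn, pow_zero]
      · rfl
  rw [this]
  field_simp

lemma X_sub_one_mul_minpoly_dvd {F L : Type*} [Field F] [Field L] [Algebra F L] {n : ℕ} {β : L}
    (hn0 : 0 < n) (hn : β ^ n = 1) (hβ : β ≠ 1) :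
    (X - 1) * minpoly F β ∣ (X ^ n - 1 : F[X]) := by
  have hint : IsIntegral F β := by
    refine ⟨X ^ n - 1, monic_X_pow_sub_C 1 hn0.ne', ?_⟩
    simp [hn]
  refine IsCoprime.mul_dvd ?_ ?_ ?_
  · have hX : Irreducible (X - C 1 : F[X]) := irreducible_X_sub_C 1
    rw [C_1] at hX
    rw [hX.coprime_iff_not_dvd]
    intro hdvd
    have h := hX.dvd_symm (minpoly.irreducible hint) hdvd
    have := minpoly.aeval F β
    obtain ⟨r, hr⟩ := h
    have h2 := congrArg (aeval β) hr
    rw [map_mul, this, zero_mul] at h2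
    simp [sub_eq_zero] at h2
    exact hβ h2
  · simpa using sub_dvd_pow_sub_pow (X : F[X]) 1 n
  · exact minpoly.dvd F β (by simp [hn])

/-- Zero positions i correspond to nonzero solutions x = α^i. The count also includes x = 0 exactly
when b = 0, hence the correction term. -/
lemma hammingNorm_traceWord {p m e : ℕ} [Fact p.Prime] {K : Type*} [Field K] [Fintype K]
    [Algebra (ZMod p) K] (hK : Fintype.card K = p ^ m) (he : e ≠ 0) {α : Kˣ}
    (hα : ∀ x : Kˣ, x ∈ Subgroup.zpowers α) (a : K) (b : ZMod p) :
    hammingNorm (traceWord p (p ^ m - 1) ((α : K) ^ e) (a, b)) + levelCount e a (-b) =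
      p ^ m - 1 + if b = 0 then 1 else 0 := by
  classical
  have hord : orderOf α = p ^ m - 1 := by
    rw [orderOf_eq_card_of_forall_mem_zpowers hα, Nat.card_eq_fintype_card, Fintype.card_units, hK]
  set c := traceWord p (p ^ m - 1) ((α : K) ^ e) (a, b) with hc
  have h1 : hammingNorm c + (Finset.univ.filter fun i => c i = 0).card = p ^ m - 1 := by
    have := Finset.card_filter_add_card_filter_not (s := Finset.univ) (fun i => c i ≠ 0)
    simp only [not_not, Finset.card_univ, Fintype.card_fin] at this
    exact this
  have h2 : (Finset.univ.filter fun i => c i = 0).card =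
      (Finset.univ.filter fun x : K =>
        x ≠ 0 ∧ Algebra.trace (ZMod p) K (a * x ^ e) = -b).card := by
    refine Finset.card_bij (fun i _ => (α : K) ^ (i : ℕ)) ?_ ?_ ?_
    · intro i hi
      have hi := (Finset.mem_filter.mp hi).2
      rw [hc, traceWord_apply, ← pow_mul, mul_comm e, pow_mul] at hi
      simp only [Finset.mem_filter, Finset.mem_univ, true_and]
      exact ⟨pow_ne_zero _ α.ne_zero, eq_neg_of_add_eq_zero_left hi⟩
    · intro i _ j _ hij
      have hij' : α ^ (i : ℕ) = α ^ (j : ℕ) := by ext; simpa using hij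
      exact Fin.ext (pow_injOn_Iio_orderOf (by simp [hord]) (by simp [hord]) hij')
    · intro x hx
      obtain ⟨hx0, hx⟩ := (Finset.mem_filter.mp hx).2
      obtain ⟨i, hi, hix⟩ := (mem_zpowers_iff_mem_range_orderOf (x := α)).mp (hα (Units.mk0 x hx0))
        |> Finset.mem_image.mp
      rw [Finset.mem_range, hord] at hi
      have hx' : (α : K) ^ i = x := by
        rw [← Units.val_pow_eq_pow_val, hix, Units.val_mk0]
      refine ⟨⟨i, hi⟩, ?_, hx'⟩
      simp only [Finset.mem_filter, Finset.mem_univ, true_and]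
      rw [hc, traceWord_apply, ← pow_mul, mul_comm e, pow_mul]
      simp only [hx', hx]
      ring
  have h3 : levelCount e a (-b) = (Finset.univ.filter fun x : K =>
      x ≠ 0 ∧ Algebra.trace (ZMod p) K (a * x ^ e) = -b).card + if b = 0 then 1 else 0 := by
    unfold levelCount
    split_ifs with hb
    · have hz : (0 : K) ∉ (Finset.univ.filter fun x : K =>
          x ≠ 0 ∧ Algebra.trace (ZMod p) K (a * x ^ e) = -b) := by simp
      rw [← Finset.card_insert_of_notMem hz]
      congr 1
      ext x
      rcases eq_or_ne x 0 with rfl | hx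
      · simp [he, hb]
      · simp [hx]
    · rw [add_zero]
      congr 1
      ext x
      rcases eq_or_ne x 0 with rfl | hx
      · simp [he, hb]
      · simp [hx]
  omega

/-- A code parametrized by an injection, together with a list of weights and of parameter sets
on which they are attained, has the weight distribution read off from the sizes of these sets. -/
lemma hasWeightDistribution_of_classes {F ι : Type*} [Field F] [DecidableEq F] {n : ℕ}
    {C : Submodule F (Fin n → F)} {f : ι → Fin n → F} (hf : Function.Injective f)
    (hC : ∀ c, c ∈ C ↔ ∃ x, f x = c) (L : List (ℕ × Set ι)) (hL : (L.map Prod.fst).Nodup)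
    (hcover : ∀ x, ∃ e ∈ L, x ∈ e.2) (hwt : ∀ e ∈ L, ∀ x ∈ e.2, hammingNorm (f x) = e.1) :
    HasWeightDistribution C (L.map fun e => (e.1, e.2.ncard)) := by
  constructor
  · intro e' he'
    obtain ⟨e, he, rfl⟩ := List.mem_map.mp he'
    have : {c : Fin n → F | c ∈ C ∧ hammingNorm c = e.1} = f '' e.2 := by
      ext c
      constructor
      · rintro ⟨hc, hw⟩
        obtain ⟨x, rfl⟩ := (hC c).mp hc
        obtain ⟨e₁, he₁, hx⟩ := hcover x
        have : e₁ = e := List.inj_on_of_nodup_map hL he₁ he ((hwt e₁ he₁ x hx).symm.trans hw)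
        exact ⟨x, this ▸ hx, rfl⟩
      · rintro ⟨x, hx, rfl⟩
        exact ⟨(hC _).mpr ⟨x, rfl⟩, hwt e he x hx⟩
    simp only [weightCount]
    rw [this, Set.ncard_image_of_injective _ hf]
  · intro w hw
    have : {c : Fin n → F | c ∈ C ∧ hammingNorm c = w} = ∅ := by
      ext c
      simp only [Set.mem_ofPred_eq, Set.mem_empty_iff_false, iff_false, not_and]
      intro hc hcw
      obtain ⟨x, rfl⟩ := (hC c).mp hc
      obtain ⟨e, he, hx⟩ := hcover x
      apply hw
      rw [List.map_map, List.mem_map]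
      exact ⟨e, he, (hwt e he x hx).symm.trans hcw⟩
    rw [weightCount, this, Set.ncard_empty]

lemma HasWeightDistribution.of_subset {F : Type*} [Field F] [DecidableEq F] {n : ℕ}
    {C : Submodule F (Fin n → F)} {L L' : List (ℕ × ℕ)} (h : HasWeightDistribution C L)
    (h1 : L' ⊆ L) (h2 : L ⊆ L') : HasWeightDistribution C L' :=
  ⟨fun e he => h.1 e (h1 he), fun w hw => h.2 w fun hw' => hw (List.map_subset _ h2 hw')⟩

lemma HasWeightDistribution.ncard_nonzero_le {F : Type*} [Field F] [DecidableEq F] {n : ℕ}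
    {C : Submodule F (Fin n → F)} {a : ℕ} {L : List (ℕ × ℕ)}
    (h : HasWeightDistribution C ((0, a) :: L)) :
    {w : ℕ | w ≠ 0 ∧ weightCount C w ≠ 0}.ncard ≤ L.length := by
  have hsub : {w : ℕ | w ≠ 0 ∧ weightCount C w ≠ 0} ⊆ ((L.map Prod.fst).toFinset : Set ℕ) := by
    rintro w ⟨hw0, hw⟩
    by_contra hmem
    apply hw
    apply h.2
    simpa [hw0] using hmem
  refine (Set.ncard_le_ncard hsub (Finset.finite_toSet _)).trans ?_
  rw [Set.ncard_coe_finset]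
  exact (List.toFinset_card_le _).trans (by simp)

/-! ### Greatest common divisors and 2-adic valuations -/

section Arithmetic

lemma sub_one_mul_two_dvd {p r : ℕ} (hp : Odd p) : (p - 1) * 2 ∣ p ^ (2 * r) - 1 := by
  have h1 : p ^ 2 - 1 ∣ p ^ (2 * r) - 1 := by
    rw [pow_mul]; exact Nat.sub_one_dvd_pow_sub_one _ _
  refine Dvd.dvd.trans ?_ h1
  obtain ⟨i, rfl⟩ := hp
  refine ⟨i + 1, ?_⟩
  rw [Nat.add_sub_cancel, Nat.sub_eq_iff_eq_add (Nat.one_le_pow _ _ (by omega))]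
  ring

lemma pow_sub_one_mul_pow_add_one (p d : ℕ) (hp : 0 < p) :
    (p ^ d - 1) * (p ^ d + 1) = p ^ (2 * d) - 1 := by
  have h : 1 ≤ p ^ d := Nat.one_le_pow _ _ hp
  rw [mul_comm 2, pow_mul, mul_comm]
  simpa using (Nat.sq_sub_sq (p ^ d) 1).symm

lemma sub_one_mul_pow_add_one_dvd {p d s : ℕ} (hp : 0 < p) :
    (p - 1) * (p ^ d + 1) ∣ p ^ (2 * (d * s)) - 1 := by
  have h1 : p ^ (2 * d) - 1 ∣ p ^ (2 * (d * s)) - 1 := by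
    rw [← mul_assoc, pow_mul p (2 * d)]; exact Nat.sub_one_dvd_pow_sub_one _ _
  refine Dvd.dvd.trans ?_ h1
  rw [← pow_sub_one_mul_pow_add_one p d hp]
  exact mul_dvd_mul_right (Nat.sub_one_dvd_pow_sub_one _ _) _

/-- For m/d odd, gcd(2k,m) = d, so the gcd divides p^d-1 and hence p^k-1; it also divides p^k+1, so
it divides 2. -/
lemma gcd_pow_add_one_of_odd {p k m : ℕ} (hp : Odd p) (hm : Odd (m / k.gcd m)) :
    (p ^ k + 1).gcd (p ^ m - 1) = 2 := by
  have hp0 := hp.pos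
  set d := k.gcd m with hd
  have hkd : d ∣ k := Nat.gcd_dvd_left _ _
  have hmd : d ∣ m := Nat.gcd_dvd_right _ _
  have hd0 : 0 < d := by
    rcases Nat.eq_zero_or_pos d with h | h
    · rw [h] at hm; simp at hm
    · exact h
  have hg : (2 * k).gcd m = d := by
    obtain ⟨t, ht⟩ := hkd
    obtain ⟨s, hs⟩ := hmd
    have hcop : t.Coprime s := by
      have := Nat.coprime_div_gcd_div_gcd (m := k) (n := m) hd0
      rwa [← hd, ht, hs, Nat.mul_div_cancel_left _ hd0, Nat.mul_div_cancel_left _ hd0] at this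
    rw [hs, Nat.mul_div_cancel_left _ hd0] at hm
    rw [ht, hs, mul_left_comm, Nat.gcd_mul_left,
      (hm.coprime_two_left.mul_left hcop : (2 * t).Coprime s), mul_one]
  have h1 : (p ^ k + 1).gcd (p ^ m - 1) ∣ p ^ d - 1 := by
    rw [← hg, ← Nat.pow_sub_one_gcd_pow_sub_one, ← pow_sub_one_mul_pow_add_one p k hp0]
    exact Nat.gcd_dvd_gcd_of_dvd_left _ (dvd_mul_left _ _)
  have h2 : (p ^ k + 1).gcd (p ^ m - 1) ∣ p ^ k - 1 :=
    h1.trans (Nat.pow_sub_one_dvd_pow_sub_one p hkd)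
  have h3 : (p ^ k + 1).gcd (p ^ m - 1) ∣ 2 := by
    have := Nat.dvd_sub (Nat.gcd_dvd_left (p ^ k + 1) (p ^ m - 1)) h2
    have hpk : 1 ≤ p ^ k := Nat.one_le_pow _ _ hp0
    rwa [show p ^ k + 1 - (p ^ k - 1) = 2 by omega] at this
  refine Nat.dvd_antisymm h3 (Nat.dvd_gcd ?_ ?_)
  · exact (hp.pow.add_odd odd_one).two_dvd
  · exact (hp.pow.tsub_odd odd_one).two_dvd

/-- Both numbers are multiples of q+1. The remaining factor divides q-1, hence both p^(dt)-1 and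
p^(dt)+1, hence 2; it also divides the odd cofactor w, so it is 1. -/
lemma gcd_pow_add_one_of_even {p d s t : ℕ} (hp : Odd p) (ht : Odd t)
    (hts : t.Coprime (2 * s)) :
    (p ^ (d * t) + 1).gcd (p ^ (2 * (d * s)) - 1) = p ^ d + 1 := by
  have hp0 := hp.pos
  set q := p ^ d with hq
  have hq1 : 1 ≤ q := Nat.one_le_pow _ _ hp0
  have hqo : Odd q := hp.pow
  obtain ⟨w, hw, hwo⟩ : ∃ w, p ^ (d * t) + 1 = (q + 1) * w ∧ Odd w := by
    -- Since t-1 is even and q odd, q^t + 1 = (q+1)(2qz+1), which shows the cofactor to be odd.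
    obtain ⟨z, hz⟩ : 2 * (q + 1) ∣ q ^ (t - 1) - 1 := by
      obtain ⟨r, hr⟩ := ht
      rw [hr, Nat.add_sub_cancel, mul_comm]
      have h2 : (q + 1) * 2 ∣ q ^ 2 - 1 := by
        have h3 : q ^ 2 - 1 = (q - 1) * (q + 1) := by
          have := pow_sub_one_mul_pow_add_one q 1 hq1
          simpa using this.symm
        rw [h3, mul_comm (q - 1)]
        exact mul_dvd_mul_left _ (hqo.tsub_odd odd_one).two_dvd
      rw [pow_mul]
      exact h2.trans (Nat.sub_one_dvd_pow_sub_one _ _)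
    refine ⟨2 * (q * z) + 1, ?_, odd_two_mul_add_one _⟩
    have h1 : q ^ (t - 1) = 2 * (q + 1) * z + 1 := by
      have : 1 ≤ q ^ (t - 1) := Nat.one_le_pow _ _ hq1
      omega
    rw [pow_mul, ← hq, ← Nat.sub_add_cancel ht.pos, pow_succ, h1]
    ring
  have hdvd : q + 1 ∣ p ^ (2 * (d * s)) - 1 :=
    (dvd_mul_left _ _).trans (sub_one_mul_pow_add_one_dvd hp0)
  have hg : (2 * (d * t)).gcd (2 * (d * s)) = 2 * d := by
    rw [← mul_assoc, ← mul_assoc, Nat.gcd_mul_left,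
      (hts.coprime_mul_left_right : t.Coprime s), mul_one]
  obtain ⟨g', hg'⟩ : q + 1 ∣ (p ^ (d * t) + 1).gcd (p ^ (2 * (d * s)) - 1) :=
    Nat.dvd_gcd ⟨w, hw⟩ hdvd
  have h1 : g' ∣ w := by
    have := Nat.gcd_dvd_left (p ^ (d * t) + 1) (p ^ (2 * (d * s)) - 1)
    rw [hg', hw] at this
    exact Nat.dvd_of_mul_dvd_mul_left (by omega) this
  have h2 : g' ∣ q - 1 := by
    have : (p ^ (d * t) + 1).gcd (p ^ (2 * (d * s)) - 1) ∣ p ^ (2 * d) - 1 := by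
      rw [← hg, ← Nat.pow_sub_one_gcd_pow_sub_one, ← pow_sub_one_mul_pow_add_one p (d * t) hp0]
      exact Nat.gcd_dvd_gcd_of_dvd_left _ (dvd_mul_left _ _)
    rw [hg', ← pow_sub_one_mul_pow_add_one p d hp0, mul_comm (p ^ d - 1)] at this
    exact Nat.dvd_of_mul_dvd_mul_left (by omega) this
  have h3 : g' ∣ 2 := by
    have h4 : g' ∣ p ^ (d * t) - 1 := by
      rw [pow_mul]; exact h2.trans (Nat.sub_one_dvd_pow_sub_one _ _)
    have h5 := Nat.dvd_sub (hw ▸ h1.mul_left (q + 1) : g' ∣ p ^ (d * t) + 1) h4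
    have : 1 ≤ p ^ (d * t) := Nat.one_le_pow _ _ hp0
    rwa [show p ^ (d * t) + 1 - (p ^ (d * t) - 1) = 2 by omega] at h5
  rcases (Nat.dvd_prime Nat.prime_two).mp h3 with h | h
  · rw [hg', h, mul_one]
  · rw [h] at h1
    exact absurd h1 hwo.not_two_dvd_nat

lemma padicValNat_two_eq_zero_iff {x : ℕ} (hx : x ≠ 0) : padicValNat 2 x = 0 ↔ Odd x := by
  rw [padicValNat.eq_zero_iff, ← Nat.not_even_iff_odd, even_iff_two_dvd]
  simp [hx]

lemma odd_div_gcd_of_padicValNat_le {k m : ℕ} (hk : 0 < k) (hm : 0 < m)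
    (h : padicValNat 2 m ≤ padicValNat 2 k) : Odd (m / k.gcd m) := by
  have hd0 : 0 < k.gcd m := Nat.gcd_pos_of_pos_left _ hk
  have hcop := Nat.coprime_div_gcd_div_gcd (m := k) (n := m) hd0
  obtain ⟨t, ht⟩ := Nat.gcd_dvd_left k m
  obtain ⟨s, hs⟩ := Nat.gcd_dvd_right k m
  have et : k / k.gcd m = t := Nat.div_eq_of_eq_mul_right hd0 ht
  have es : m / k.gcd m = s := Nat.div_eq_of_eq_mul_right hd0 hs
  rw [et, es] at hcop
  rw [es]
  have ht0 : t ≠ 0 := by rintro rfl; omega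
  have hs0 : s ≠ 0 := by rintro rfl; omega
  have hk2 : padicValNat 2 k = padicValNat 2 (k.gcd m) + padicValNat 2 t := by
    conv_lhs => rw [ht]
    exact padicValNat.mul hd0.ne' ht0
  have hm2 : padicValNat 2 m = padicValNat 2 (k.gcd m) + padicValNat 2 s := by
    conv_lhs => rw [hs]
    exact padicValNat.mul hd0.ne' hs0
  by_contra hodd
  have hts : ¬ Odd t := by
    rw [← padicValNat_two_eq_zero_iff ht0]
    rw [← padicValNat_two_eq_zero_iff hs0] at hodd
    omega
  rw [Nat.not_odd_iff_even, even_iff_two_dvd] at hodd hts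
  exact Nat.not_coprime_of_dvd_of_dvd one_lt_two hts hodd hcop

/-- The parity of s decides between the last two cases: s is odd exactly when the valuations differ
by 1. -/
lemma exists_of_padicValNat_lt {k m : ℕ} (hk : 0 < k) (hm : 0 < m)
    (h : padicValNat 2 k < padicValNat 2 m) :
    ∃ s t, m = 2 * (k.gcd m * s) ∧ k = k.gcd m * t ∧ Odd t ∧ t.Coprime (2 * s) ∧
      padicValNat 2 m = padicValNat 2 k + 1 + padicValNat 2 s := by
  have hd0 : 0 < k.gcd m := Nat.gcd_pos_of_pos_left _ hk
  have hcop := Nat.coprime_div_gcd_div_gcd (m := k) (n := m) hd0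
  obtain ⟨t, ht⟩ := Nat.gcd_dvd_left k m
  obtain ⟨s', hs⟩ := Nat.gcd_dvd_right k m
  have et : k / k.gcd m = t := Nat.div_eq_of_eq_mul_right hd0 ht
  have es : m / k.gcd m = s' := Nat.div_eq_of_eq_mul_right hd0 hs
  rw [et, es] at hcop
  have ht0 : t ≠ 0 := by rintro rfl; omega
  have hs0 : s' ≠ 0 := by rintro rfl; omega
  have hk2 : padicValNat 2 k = padicValNat 2 (k.gcd m) + padicValNat 2 t := by
    conv_lhs => rw [ht]
    exact padicValNat.mul hd0.ne' ht0
  have hm2 : padicValNat 2 m = padicValNat 2 (k.gcd m) + padicValNat 2 s' := by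
    conv_lhs => rw [hs]
    exact padicValNat.mul hd0.ne' hs0
  have hseven : 2 ∣ s' := by
    rw [← even_iff_two_dvd, ← Nat.not_odd_iff_even, ← padicValNat_two_eq_zero_iff hs0]
    omega
  have htodd : Odd t := by
    rw [← Nat.not_even_iff_odd, even_iff_two_dvd]
    exact fun h2 => Nat.not_coprime_of_dvd_of_dvd one_lt_two h2 hseven hcop
  obtain ⟨s, rfl⟩ := hseven
  refine ⟨s, t, by linarith, ht, htodd, hcop, ?_⟩
  have hs2 : padicValNat 2 (2 * s) = padicValNat 2 2 + padicValNat 2 s :=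
    padicValNat.mul two_ne_zero (by rintro rfl; exact hs0 rfl)
  rw [padicValNat_self] at hs2
  rw [hm2, hk2, hs2, (padicValNat_two_eq_zero_iff ht0).mpr htodd]
  ring

end Arithmetic

/-! ### From level counts to weight distributions -/

section Distribution

variable {p : ℕ} [Fact p.Prime]

lemma ncard_compl_zero : ({0}ᶜ : Set (ZMod p)).ncard = p - 1 := by
  rw [Set.ncard_compl, Set.ncard_singleton, Nat.card_zmod]

lemma ncard_of_fibers {ι : Type*} [Finite ι] {S : Set (ι × ZMod p)} {c : ℕ}
    (h0 : ∀ a, (a, (0 : ZMod p)) ∉ S) (hc : ∀ b : ZMod p, b ≠ 0 → {a | (a, b) ∈ S}.ncard = c) :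
    S.ncard = (p - 1) * c := by
  classical
  have := Fintype.ofFinite ι
  have hfib : ∀ b : ZMod p, (S.toFinset.filter fun x => x.2 = b).card = {a | (a, b) ∈ S}.ncard := by
    intro b
    rw [Set.ncard_eq_toFinset_card']
    refine Finset.card_bij (fun x _ => x.1) ?_ ?_ ?_
    · rintro ⟨a, b'⟩ hx
      simp at hx ⊢
      rcases hx with ⟨hx, rfl⟩
      exact hx
    · rintro ⟨a, b1⟩ hx ⟨a', b2⟩ hx' h
      simp at hx hx' h
      rw [h, hx.2, hx'.2]
    · intro a ha
      simp at ha
      exact ⟨(a, b), by simpa using ha, rfl⟩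
  rw [Set.ncard_eq_toFinset_card', Finset.card_eq_sum_card_fiberwise (f := Prod.snd)
    (t := Finset.univ) (by intro x _; simp),
    ← Finset.add_sum_erase _ _ (Finset.mem_univ (0 : ZMod p)),
    Finset.sum_congr rfl fun b hb => (hfib b).trans (hc b (Finset.ne_of_mem_erase hb)), hfib]
  simp [h0, ZMod.card]

lemma injective_of_hammingNorm_ne_zero {K : Type*} [Field K] [Algebra (ZMod p) K] {n : ℕ}
    {f : K × ZMod p →ₗ[ZMod p] (Fin n → ZMod p)}
    (h : ∀ a b, (a, b) ≠ ((0, 0) : K × ZMod p) → hammingNorm (f (a, b)) ≠ 0) :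
    Function.Injective f := by
  rw [injective_iff_map_eq_zero]
  rintro ⟨a, b⟩ hab
  by_contra hne
  exact h a b hne (by rw [hab, hammingNorm_zero])

variable {K : Type*} [Field K] [Fintype K] [Algebra (ZMod p) K]

lemma hammingNorm_eq_of_eq_zero {m e n : ℕ}
    {f : K × ZMod p →ₗ[ZMod p] (Fin n → ZMod p)}
    (hf : ∀ a b, hammingNorm (f (a, b)) + levelCount e a (-b) = p ^ m - 1 + if b = 0 then 1 else 0)
    {b : ZMod p} (hb : b ≠ 0) : hammingNorm (f (0, b)) = p ^ m - 1 := by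
  have h := hf 0 b
  rwa [levelCount_zero, if_neg (neg_ne_zero.mpr hb), if_neg hb] at h

/-- Separates the weights with b = 0, divisible by p, from those with b ≠ 0, congruent to -1 mod p.
-/
lemma ne_of_dvd_of_dvd_add_one {p x y : ℕ} (hp : 1 < p) (hx : p ∣ x) (hy : p ∣ y + 1) : x ≠ y := by
  rintro rfl
  have := (Nat.dvd_add_right hx).mp hy
  exact absurd (Nat.dvd_one.mp this) hp.ne'

/-- Each value of the deviation gives one weight for b = 0 and one for b ≠ 0. The bounds on i and j
make all these weights positive and distinct, which yields injectivity too; x and y count the a of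
each kind. -/
lemma hasWeightDistribution_of_deviation (hp : p ≠ 2) {m e i j n : ℕ} (he0 : e ≠ 0)
    (hK : Fintype.card K = p ^ m)
    (he : (p - 1) * e ∣ p ^ m - 1) (hi : 0 < i) (him : i < m - 1) (hj : 0 < j) (hjm : j < m - 1)
    (f : K × ZMod p →ₗ[ZMod p] (Fin n → ZMod p))
    (hf : ∀ a b, hammingNorm (f (a, b)) + levelCount e a (-b) = p ^ m - 1 + if b = 0 then 1 else 0)
    (hdev : ∀ a : K, a ≠ 0 → deviation p m e a = p ^ i ∨ deviation p m e a = -p ^ j) :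
    Function.Injective f ∧ ∃ x y : ℕ, x + y = p ^ m - 1 ∧ x * p ^ i = y * p ^ j ∧
      HasWeightDistribution (LinearMap.range f)
        [(0, 1), (p ^ m - 1, p - 1),
         ((p - 1) * (p ^ (m - 1) - p ^ i), x), ((p - 1) * p ^ (m - 1) + p ^ i - 1, x * (p - 1)),
         ((p - 1) * (p ^ (m - 1) + p ^ j), y), ((p - 1) * p ^ (m - 1) - p ^ j - 1, y * (p - 1))] := by
  classical
  have hp3 : 3 ≤ p := by
    have := (Fact.out : p.Prime).two_le
    omega
  have hm : 0 < m := by omega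
  have hdA : p ∣ p ^ (m - 1) := dvd_pow_self p (by omega)
  have hdI : p ∣ p ^ i := dvd_pow_self p (by omega)
  have hdJ : p ∣ p ^ j := dvd_pow_self p (by omega)
  have hI1 : p ≤ p ^ i := Nat.le_self_pow hi.ne' p
  have hJ1 : p ≤ p ^ j := Nat.le_self_pow hj.ne' p
  have hIA : p ^ i < p ^ (m - 1) := Nat.pow_lt_pow_right (by omega) him
  have hJA : p ^ j < p ^ (m - 1) := Nat.pow_lt_pow_right (by omega) hjm
  have hpm : p ^ m = (p - 1) * p ^ (m - 1) + p ^ (m - 1) := by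
    rw [← Nat.succ_mul, Nat.succ_eq_add_one, Nat.sub_add_cancel (by omega), ← pow_succ',
      Nat.sub_add_cancel hm]
  have hAm : 2 * p ^ (m - 1) ≤ (p - 1) * p ^ (m - 1) := Nat.mul_le_mul_right _ (by omega)
  have hIm : 2 * p ^ i ≤ (p - 1) * p ^ i := Nat.mul_le_mul_right _ (by omega)
  have hJm : 2 * p ^ j ≤ (p - 1) * p ^ j := Nat.mul_le_mul_right _ (by omega)
  have hIAm : (p - 1) * p ^ i < (p - 1) * p ^ (m - 1) :=
    Nat.mul_lt_mul_of_pos_left hIA (by omega)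
  have hne : ((p : ℤ) ^ i) ≠ -p ^ j := by
    have h1 : (0 : ℤ) < p ^ i := by positivity
    have h2 : (0 : ℤ) < p ^ j := by positivity
    omega
  have e0 := fun a : K => levelCount_zero_eq hK hm he a
  have e1 := fun (a : K) (b : ZMod p) (hb : b ≠ 0) =>
    levelCount_ne_zero_eq hK he a (neg_ne_zero.mpr hb)
  have hpZ : ((p - 1 : ℕ) : ℤ) = p - 1 := by push_cast [Nat.cast_sub (show 1 ≤ p by omega)]; ring
  have hfa0 : ∀ a : K, hammingNorm (f (a, 0)) + levelCount e a (0 : ZMod p) = p ^ m := by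
    intro a
    have h := hf a 0
    rw [neg_zero, if_pos rfl] at h
    omega
  have hfab : ∀ (a : K) (b : ZMod p), b ≠ 0 →
      hammingNorm (f (a, b)) + levelCount e a (-b) = p ^ m - 1 := by
    intro a b hb
    have h := hf a b
    rwa [if_neg hb] at h
  have w2 : ∀ a : K, deviation p m e a = p ^ i →
      hammingNorm (f (a, 0)) = (p - 1) * (p ^ (m - 1) - p ^ i) := by
    intro a ha
    have h1 := hfa0 a
    have h2 : levelCount e a (0 : ZMod p) = p ^ (m - 1) + (p - 1) * p ^ i := by
      have := e0 a
      rw [ha, ← hpZ] at this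
      exact_mod_cast this
    rw [Nat.mul_sub]
    omega
  have w4 : ∀ a : K, deviation p m e a = -p ^ j →
      hammingNorm (f (a, 0)) = (p - 1) * (p ^ (m - 1) + p ^ j) := by
    intro a ha
    have h1 := hfa0 a
    have h2 : levelCount e a (0 : ZMod p) + (p - 1) * p ^ j = p ^ (m - 1) := by
      have := e0 a
      rw [ha, ← hpZ] at this
      have h3 : (levelCount e a (0 : ZMod p) : ℤ) + (p - 1 : ℕ) * p ^ j = p ^ (m - 1) := by
        linear_combination this
      exact_mod_cast h3
    rw [Nat.mul_add]
    omega
  have w3 : ∀ (a : K) (b : ZMod p), b ≠ 0 → deviation p m e a = p ^ i →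
      hammingNorm (f (a, b)) = (p - 1) * p ^ (m - 1) + p ^ i - 1 := by
    intro a b hb ha
    have h1 := hfab a b hb
    have h2 : levelCount e a (-b) + p ^ i = p ^ (m - 1) := by
      have := e1 a b hb
      rw [ha] at this
      have h3 : (levelCount e a (-b) : ℤ) + p ^ i = p ^ (m - 1) := by linear_combination this
      exact_mod_cast h3
    omega
  have w5 : ∀ (a : K) (b : ZMod p), b ≠ 0 → deviation p m e a = -p ^ j →
      hammingNorm (f (a, b)) = (p - 1) * p ^ (m - 1) - p ^ j - 1 := by
    intro a b hb ha
    have h1 := hfab a b hb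
    have h2 : levelCount e a (-b) = p ^ (m - 1) + p ^ j := by
      have := e1 a b hb
      rw [ha, sub_neg_eq_add] at this
      exact_mod_cast this
    omega
  have w0 : hammingNorm (f (0, 0)) = 0 := by
    rw [show ((0, 0) : K × ZMod p) = 0 from rfl, map_zero, hammingNorm_zero]
  have w1 := fun (b : ZMod p) (hb : b ≠ 0) => hammingNorm_eq_of_eq_zero hf hb
  have d2 : p ∣ (p - 1) * (p ^ (m - 1) - p ^ i) := (Nat.dvd_sub hdA hdI).mul_left _
  have d4 : p ∣ (p - 1) * (p ^ (m - 1) + p ^ j) := (Nat.dvd_add hdA hdJ).mul_left _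
  have d1 : p ∣ p ^ m - 1 + 1 := by
    rw [Nat.sub_add_cancel (by omega)]; exact dvd_pow_self p hm.ne'
  have d3 : p ∣ (p - 1) * p ^ (m - 1) + p ^ i - 1 + 1 := by
    rw [Nat.sub_add_cancel (by omega)]; exact Nat.dvd_add (hdA.mul_left _) hdI
  have d5 : p ∣ (p - 1) * p ^ (m - 1) - p ^ j - 1 + 1 := by
    rw [Nat.sub_add_cancel (by omega)]; exact Nat.dvd_sub (hdA.mul_left _) hdJ
  have hp1 : 1 < p := by omega
  have hne' : ∀ {x y : ℕ}, p ∣ x → p ∣ y + 1 → x ≠ y := fun hx hy =>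
    ne_of_dvd_of_dvd_add_one hp1 hx hy
  have v2 : 0 < (p - 1) * (p ^ (m - 1) - p ^ i) := Nat.mul_pos (by omega) (by omega)
  have v24 : (p - 1) * (p ^ (m - 1) - p ^ i) < (p - 1) * (p ^ (m - 1) + p ^ j) :=
    Nat.mul_lt_mul_of_pos_left (by omega) (by omega)
  have hinj : Function.Injective f := by
    refine injective_of_hammingNorm_ne_zero fun a b hab => ?_
    by_cases ha : a = 0
    · subst ha
      have hb : b ≠ 0 := by rintro rfl; exact hab rfl
      rw [w1 b hb]; omega
    · by_cases hb : b = 0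
      · subst hb
        rcases hdev a ha with h | h
        · rw [w2 a h]; omega
        · rw [w4 a h]; omega
      · rcases hdev a ha with h | h
        · rw [w3 a b hb h]; omega
        · rw [w5 a b hb h]; omega
  obtain ⟨hxy, hxy'⟩ := card_of_two_values hK hne hdev (sum_deviation hK hm he0)
  set U := {a : K | a ≠ 0 ∧ deviation p m e a = p ^ i} with hU
  set V := {a : K | a ≠ 0 ∧ deviation p m e a = -p ^ j} with hV
  refine ⟨hinj, U.ncard, V.ncard, ?_, ?_, ?_⟩
  · have : ((p ^ m - 1 : ℕ) : ℤ) = p ^ m - 1 := by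
      push_cast [Nat.cast_sub (show 1 ≤ p ^ m by omega)]; ring
    rw [← this] at hxy
    exact_mod_cast hxy
  · have : (U.ncard : ℤ) * p ^ i = V.ncard * p ^ j := by linear_combination hxy'
    exact_mod_cast this
  · have key := hasWeightDistribution_of_classes hinj (fun c => LinearMap.mem_range)
      [(0, {((0, 0) : K × ZMod p)}), (p ^ m - 1, {0} ×ˢ {0}ᶜ),
       ((p - 1) * (p ^ (m - 1) - p ^ i), U ×ˢ {0}),
       ((p - 1) * p ^ (m - 1) + p ^ i - 1, U ×ˢ {0}ᶜ),
       ((p - 1) * (p ^ (m - 1) + p ^ j), V ×ˢ {0}),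
       ((p - 1) * p ^ (m - 1) - p ^ j - 1, V ×ˢ {0}ᶜ)] ?_ ?_ ?_
    · simpa [Set.ncard_prod, ncard_compl_zero] using key
    · simp only [List.map_cons, List.map_nil, List.nodup_cons, List.mem_cons, List.not_mem_nil,
        or_false, not_or, not_false_eq_true, List.nodup_nil, and_true]
      refine ⟨⟨by omega, by omega, by omega, by omega, by omega⟩, ⟨(hne' d2 d1).symm, by omega,
        (hne' d4 d1).symm, by omega⟩, ⟨hne' d2 d3, by omega, hne' d2 d5⟩, ⟨(hne' d4 d3).symm,
        by omega⟩, hne' d4 d5⟩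
    · rintro ⟨a, b⟩
      by_cases ha : a = 0 <;> by_cases hb : b = 0
      · exact ⟨(0, {((0, 0) : K × ZMod p)}), by simp, by simp [ha, hb]⟩
      · exact ⟨(p ^ m - 1, {0} ×ˢ {0}ᶜ), by simp, by simp [ha, hb]⟩
      · rcases hdev a ha with h | h
        · exact ⟨((p - 1) * (p ^ (m - 1) - p ^ i), U ×ˢ {0}), by simp, ⟨ha, h⟩, hb⟩
        · exact ⟨((p - 1) * (p ^ (m - 1) + p ^ j), V ×ˢ {0}), by simp, ⟨ha, h⟩, hb⟩
      · rcases hdev a ha with h | h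
        · exact ⟨((p - 1) * p ^ (m - 1) + p ^ i - 1, U ×ˢ {0}ᶜ), by simp, ⟨ha, h⟩, hb⟩
        · exact ⟨((p - 1) * p ^ (m - 1) - p ^ j - 1, V ×ˢ {0}ᶜ), by simp, ⟨ha, h⟩, hb⟩
    · simp only [List.forall_mem_cons, List.not_mem_nil, false_imp_iff, implies_true, and_true]
      refine ⟨?_, ?_, ?_, ?_, ?_, ?_⟩
      · rintro _ rfl; exact w0
      · rintro ⟨a, b⟩ ⟨rfl, hb⟩; exact w1 b hb
      · rintro ⟨a, b⟩ ⟨⟨ha, h⟩, rfl⟩; exact w2 a h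
      · rintro ⟨a, b⟩ ⟨⟨ha, h⟩, hb⟩; exact w3 a b hb h
      · rintro ⟨a, b⟩ ⟨⟨ha, h⟩, rfl⟩; exact w4 a h
      · rintro ⟨a, b⟩ ⟨⟨ha, h⟩, hb⟩; exact w5 a b hb h

lemma hasWeightDistribution_of_odd (hp : p ≠ 2) {m n : ℕ} (hK : Fintype.card K = p ^ m)
    (hmo : Odd m) (hm1 : 1 < m) (f : K × ZMod p →ₗ[ZMod p] (Fin n → ZMod p))
    (hf : ∀ a b, hammingNorm (f (a, b)) + levelCount 2 a (-b) = p ^ m - 1 + if b = 0 then 1 else 0) :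
    Function.Injective f ∧ HasWeightDistribution (LinearMap.range f)
      [(0, 1), (p ^ m - 1, p - 1), ((p - 1) * p ^ (m - 1), p ^ m - 1),
       ((p - 1) * p ^ (m - 1) - p ^ ((m - 1) / 2) - 1, (p - 1) / 2 * (p ^ m - 1)),
       ((p - 1) * p ^ (m - 1) + p ^ ((m - 1) / 2) - 1, (p - 1) / 2 * (p ^ m - 1))] := by
  classical
  have hp3 : 3 ≤ p := by
    have := (Fact.out : p.Prime).two_le
    omega
  have hpo : Odd p := (Fact.out : p.Prime).odd_of_ne_two hp
  have hm : 0 < m := by omega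
  set i := (m - 1) / 2 with hi'
  have hi : 0 < i := by obtain ⟨r, rfl⟩ := hmo; omega
  have him : i < m - 1 := by omega
  have hdA : p ∣ p ^ (m - 1) := dvd_pow_self p (by omega)
  have hdI : p ∣ p ^ i := dvd_pow_self p (by omega)
  have hI1 : p ≤ p ^ i := Nat.le_self_pow hi.ne' p
  have hIA : p ^ i < p ^ (m - 1) := Nat.pow_lt_pow_right (by omega) him
  have hpm : p ^ m = (p - 1) * p ^ (m - 1) + p ^ (m - 1) := by
    rw [← Nat.succ_mul, Nat.succ_eq_add_one, Nat.sub_add_cancel (by omega), ← pow_succ',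
      Nat.sub_add_cancel hm]
  have hAm : 2 * p ^ (m - 1) ≤ (p - 1) * p ^ (m - 1) := Nat.mul_le_mul_right _ (by omega)
  have hfab : ∀ (a : K) (b : ZMod p), b ≠ 0 →
      hammingNorm (f (a, b)) + levelCount 2 a (-b) = p ^ m - 1 := by
    intro a b hb
    have h := hf a b
    rwa [if_neg hb] at h
  have w0 : hammingNorm (f (0, 0)) = 0 := by
    rw [show ((0, 0) : K × ZMod p) = 0 from rfl, map_zero, hammingNorm_zero]
  have w1 := fun (b : ZMod p) (hb : b ≠ 0) => hammingNorm_eq_of_eq_zero hf hb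
  have w2 : ∀ a : K, a ≠ 0 → hammingNorm (f (a, 0)) = (p - 1) * p ^ (m - 1) := by
    intro a ha
    have h := hf a 0
    rw [neg_zero, if_pos rfl, levelCount_two_zero_of_odd hp hK hmo ha] at h
    omega
  have w3 : ∀ (a : K) (b : ZMod p), b ≠ 0 → (levelCount 2 a (-b) : ℤ) - p ^ (m - 1) = p ^ i →
      hammingNorm (f (a, b)) = (p - 1) * p ^ (m - 1) - p ^ i - 1 := by
    intro a b hb h
    have h1 := hfab a b hb
    have h2 : levelCount 2 a (-b) = p ^ (m - 1) + p ^ i := by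
      have : (levelCount 2 a (-b) : ℤ) = p ^ (m - 1) + p ^ i := by linear_combination h
      exact_mod_cast this
    omega
  have w4 : ∀ (a : K) (b : ZMod p), b ≠ 0 → (levelCount 2 a (-b) : ℤ) - p ^ (m - 1) = -p ^ i →
      hammingNorm (f (a, b)) = (p - 1) * p ^ (m - 1) + p ^ i - 1 := by
    intro a b hb h
    have h1 := hfab a b hb
    have h2 : levelCount 2 a (-b) + p ^ i = p ^ (m - 1) := by
      have : (levelCount 2 a (-b) : ℤ) + p ^ i = p ^ (m - 1) := by linear_combination h
      exact_mod_cast this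
    omega
  have hdev := fun (a : K) (ha : a ≠ 0) (b : ZMod p) (hb : b ≠ 0) =>
    levelCount_two_of_odd hp hK hmo ha (neg_ne_zero.mpr hb)
  have hinj : Function.Injective f := by
    refine injective_of_hammingNorm_ne_zero fun a b hab => ?_
    by_cases ha : a = 0
    · subst ha
      have hb : b ≠ 0 := by rintro rfl; exact hab rfl
      rw [w1 b hb]; omega
    · by_cases hb : b = 0
      · subst hb
        rw [w2 a ha]; omega
      · rcases hdev a ha b hb with h | h
        · rw [w3 a b hb h]; omega
        · rw [w4 a b hb h]; omega
  refine ⟨hinj, ?_⟩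
  -- For m odd the sign depends on b as well as a, so the classes are sets of pairs, counted
  -- fibrewise over b.
  set U := {x : K × ZMod p | x.1 ≠ 0 ∧ x.2 ≠ 0 ∧
    (levelCount 2 x.1 (-x.2) : ℤ) - p ^ (m - 1) = p ^ i} with hU
  set V := {x : K × ZMod p | x.1 ≠ 0 ∧ x.2 ≠ 0 ∧
    (levelCount 2 x.1 (-x.2) : ℤ) - p ^ (m - 1) = -p ^ i} with hV
  have hhalf : (p - 1) * ((p ^ m - 1) / 2) = (p - 1) / 2 * (p ^ m - 1) := by
    have h1 : 2 ∣ p - 1 := (hpo.tsub_odd odd_one).two_dvd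
    have h2 : 2 ∣ p ^ m - 1 := (hpo.pow.tsub_odd odd_one).two_dvd
    rw [← Nat.mul_div_assoc _ h2, Nat.div_mul_right_comm h1]
  have cU : U.ncard = (p - 1) / 2 * (p ^ m - 1) := by
    rw [← hhalf]
    refine ncard_of_fibers (by simp [hU]) fun b hb => ?_
    rw [← (card_levelCount_two_of_odd (K := K) hp hK hmo (neg_ne_zero.mpr hb)).1]
    congr 1; ext a; simp [hU, hb, ← hi']
  have cV : V.ncard = (p - 1) / 2 * (p ^ m - 1) := by
    rw [← hhalf]
    refine ncard_of_fibers (by simp [hV]) fun b hb => ?_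
    rw [← (card_levelCount_two_of_odd (K := K) hp hK hmo (neg_ne_zero.mpr hb)).2]
    congr 1; ext a; simp [hV, hb, ← hi']
  have cK : ({0}ᶜ : Set K).ncard = p ^ m - 1 := by
    rw [Set.ncard_compl, Set.ncard_singleton, Nat.card_eq_fintype_card, hK]
  have d2 : p ∣ (p - 1) * p ^ (m - 1) := hdA.mul_left _
  have d1 : p ∣ p ^ m - 1 + 1 := by
    rw [Nat.sub_add_cancel (by omega)]; exact dvd_pow_self p hm.ne'
  have d3 : p ∣ (p - 1) * p ^ (m - 1) - p ^ i - 1 + 1 := by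
    rw [Nat.sub_add_cancel (by omega)]; exact Nat.dvd_sub (hdA.mul_left _) hdI
  have d4 : p ∣ (p - 1) * p ^ (m - 1) + p ^ i - 1 + 1 := by
    rw [Nat.sub_add_cancel (by omega)]; exact Nat.dvd_add (hdA.mul_left _) hdI
  have hp1 : 1 < p := by omega
  have key := hasWeightDistribution_of_classes hinj (fun c => LinearMap.mem_range)
    [(0, {((0, 0) : K × ZMod p)}), (p ^ m - 1, {0} ×ˢ {0}ᶜ),
     ((p - 1) * p ^ (m - 1), {0}ᶜ ×ˢ {0}),
     ((p - 1) * p ^ (m - 1) - p ^ i - 1, U), ((p - 1) * p ^ (m - 1) + p ^ i - 1, V)] ?_ ?_ ?_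
  · simpa [Set.ncard_prod, ncard_compl_zero, cK, cU, cV] using key
  · simp only [List.map_cons, List.map_nil, List.nodup_cons, List.mem_cons, List.not_mem_nil,
      or_false, not_or, not_false_eq_true, List.nodup_nil, and_true]
    refine ⟨⟨by omega, by omega, by omega, by omega⟩,
      ⟨(ne_of_dvd_of_dvd_add_one hp1 d2 d1).symm, by omega, by omega⟩,
      ⟨ne_of_dvd_of_dvd_add_one hp1 d2 d3, ne_of_dvd_of_dvd_add_one hp1 d2 d4⟩, by omega⟩
  · rintro ⟨a, b⟩
    by_cases ha : a = 0 <;> by_cases hb : b = 0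
    · exact ⟨(0, {((0, 0) : K × ZMod p)}), by simp, by simp [ha, hb]⟩
    · exact ⟨(p ^ m - 1, {0} ×ˢ {0}ᶜ), by simp, by simp [ha, hb]⟩
    · exact ⟨((p - 1) * p ^ (m - 1), {0}ᶜ ×ˢ {0}), by simp, ha, hb⟩
    · rcases hdev a ha b hb with h | h
      · exact ⟨((p - 1) * p ^ (m - 1) - p ^ i - 1, U), by simp, ha, hb, h⟩
      · exact ⟨((p - 1) * p ^ (m - 1) + p ^ i - 1, V), by simp, ha, hb, h⟩
  · simp only [List.forall_mem_cons, List.not_mem_nil, false_imp_iff, implies_true, and_true]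
    refine ⟨?_, ?_, ?_, ?_, ?_⟩
    · rintro _ rfl; exact w0
    · rintro ⟨a, b⟩ ⟨rfl, hb⟩; exact w1 b hb
    · rintro ⟨a, b⟩ ⟨ha, rfl⟩; exact w2 a ha
    · rintro ⟨a, b⟩ ⟨ha, hb, h⟩; exact w3 a b hb h
    · rintro ⟨a, b⟩ ⟨ha, hb, h⟩; exact w4 a b hb h

end Distribution

lemma pow_pow_add_one_inv_ne_one {p : ℕ} [Fact p.Prime] {K : Type*} [Field K]
    [Fintype K] {m k : ℕ} (hp : p ≠ 2) (hK : Fintype.card K = p ^ m)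
    (hk : 0 < k) (hkm : k < m) {α : Kˣ} (hα : ∀ x : Kˣ, x ∈ Subgroup.zpowers α) :
    (((α : K) ^ (p ^ k + 1))⁻¹) ≠ 1 := by
  classical
  have hp3 : 3 ≤ p := by
    have := (Fact.out : p.Prime).two_le
    omega
  have hord : orderOf α = p ^ m - 1 := by
    rw [orderOf_eq_card_of_forall_mem_zpowers hα, Nat.card_eq_fintype_card, Fintype.card_units, hK]
  intro h
  rw [inv_eq_one] at h
  have h1 : α ^ (p ^ k + 1) = 1 := by ext; simpa using h
  have h2 := Nat.le_of_dvd (by omega) (orderOf_dvd_of_pow_eq_one h1)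
  rw [hord] at h2
  have h3 : p ^ (k + 1) ≤ p ^ m := Nat.pow_le_pow_right (by omega) hkm
  have h4 : p ^ k * 3 ≤ p ^ (k + 1) := by rw [pow_succ]; exact Nat.mul_le_mul_left _ hp3
  have h5 : 1 ≤ p ^ k := Nat.one_le_pow _ _ (by omega)
  have h6 : p ≤ p ^ k := Nat.le_self_pow hk.ne' p
  omega

/-! ### The cases with m even -/

section Cases

variable {p : ℕ} [Fact p.Prime] {K : Type*} [Field K] [Fintype K] [Algebra (ZMod p) K]

lemma hasWeightDistribution_of_two_mul (hp : p ≠ 2) {r n : ℕ} (hK : Fintype.card K = p ^ (2 * r))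
    (hr : 1 < r) (f : K × ZMod p →ₗ[ZMod p] (Fin n → ZMod p))
    (hf : ∀ a b, hammingNorm (f (a, b)) + levelCount 2 a (-b) =
      p ^ (2 * r) - 1 + if b = 0 then 1 else 0) :
    Function.Injective f ∧ HasWeightDistribution (LinearMap.range f)
      [(0, 1), (p ^ (2 * r) - 1, p - 1),
       ((p - 1) * p ^ (2 * r - 1) - p ^ ((2 * r - 2) / 2) - 1, (p - 1) / 2 * (p ^ (2 * r) - 1)),
       ((p - 1) * p ^ (2 * r - 1) + p ^ ((2 * r - 2) / 2) - 1, (p - 1) / 2 * (p ^ (2 * r) - 1)),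
       ((p - 1) * (p ^ (2 * r - 1) - p ^ ((2 * r - 2) / 2)), (p ^ (2 * r) - 1) / 2),
       ((p - 1) * (p ^ (2 * r - 1) + p ^ ((2 * r - 2) / 2)), (p ^ (2 * r) - 1) / 2)] := by
  have hpo : Odd p := (Fact.out : p.Prime).odd_of_ne_two hp
  have he := sub_one_mul_two_dvd (r := r) hpo
  obtain ⟨hinj, x, y, hxy, hxy', h⟩ := hasWeightDistribution_of_deviation hp two_ne_zero hK he
    (i := r - 1) (j := r - 1) (by omega) (by omega) (by omega) (by omega) f hf
    (fun a ha => deviation_two_eq hp (by omega) hK he ha)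
  refine ⟨hinj, ?_⟩
  have hx : x = y := Nat.eq_of_mul_eq_mul_right (Nat.pow_pos hpo.pos) hxy'
  have hx2 : (p ^ (2 * r) - 1) / 2 = x := by omega
  have hx3 : (p - 1) / 2 * (p ^ (2 * r) - 1) = x * (p - 1) := by
    obtain ⟨w, hw⟩ := (hpo.tsub_odd odd_one).two_dvd
    rw [hw, Nat.mul_div_cancel_left _ two_pos, ← hxy, ← hx]
    ring
  rw [← hx] at h
  rw [hx3, hx2, show (2 * r - 2) / 2 = r - 1 by omega]
  exact h.of_subset (by intro e; simp; tauto) (by intro e; simp; tauto)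

lemma pow_mul_eq_div {q x y N : ℕ} (h : y * q = x) (hxy : x + y = N) :
    y = N / (q + 1) ∧ x = q * N / (q + 1) := by
  have hN : N = y * (q + 1) := by rw [← hxy, ← h]; ring
  constructor
  · rw [hN, Nat.mul_div_cancel _ (by omega)]
  · rw [hN, ← mul_assoc, Nat.mul_div_cancel _ (by omega), ← h, mul_comm]

lemma hasWeightDistribution_of_odd_half (hp : p ≠ 2) {d s n : ℕ}
    (hK : Fintype.card K = p ^ (2 * (d * s))) (hd : 0 < d) (hs1 : 1 < s) (hs : Odd s)
    (f : K × ZMod p →ₗ[ZMod p] (Fin n → ZMod p))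
    (hf : ∀ a b, hammingNorm (f (a, b)) + levelCount (p ^ d + 1) a (-b) =
      p ^ (2 * (d * s)) - 1 + if b = 0 then 1 else 0) {m : ℕ} (hm : m = 2 * (d * s)) :
    Function.Injective f ∧ HasWeightDistribution (LinearMap.range f)
      [(0, 1), (p ^ m - 1, p - 1),
       ((p - 1) * (p ^ (m - 1) + p ^ ((m - 2) / 2)), p ^ d * (p ^ m - 1) / (p ^ d + 1)),
       ((p - 1) * p ^ (m - 1) - p ^ ((m - 2) / 2) - 1,
          p ^ d * (p - 1) * (p ^ m - 1) / (p ^ d + 1)),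
       ((p - 1) * (p ^ (m - 1) - p ^ ((m + 2 * d - 2) / 2)), (p ^ m - 1) / (p ^ d + 1)),
       ((p - 1) * p ^ (m - 1) + p ^ ((m + 2 * d - 2) / 2) - 1,
          (p - 1) * (p ^ m - 1) / (p ^ d + 1))] := by
  have hp0 : 0 < p := (Fact.out : p.Prime).pos
  have he := sub_one_mul_pow_add_one_dvd (p := p) (d := d) (s := s) hp0
  have hds : d * 2 ≤ d * s := Nat.mul_le_mul_left d hs1
  obtain ⟨hinj, x, y, hxy, hxy', h⟩ := hasWeightDistribution_of_deviation hp (by omega) hK he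
    -- For s odd the positive deviation is the one with the large radical; for s even the roles are
    -- exchanged.
    (i := d * s - 1 + d) (j := d * s - 1) (by omega) (by omega) (by omega) (by omega) f hf
    (fun a ha => by
      have := deviation_eq hp hd (by omega) hK ha he
      rw [hs.neg_one_pow] at this
      simpa using this.symm)
  refine ⟨hinj, ?_⟩
  rw [pow_add, mul_left_comm, mul_comm, mul_comm y] at hxy'
  have hy : x * p ^ d = y := by
    apply Nat.eq_of_mul_eq_mul_left (Nat.pow_pos hp0 : 0 < p ^ (d * s - 1))
    linarith
  obtain ⟨e1, e2⟩ := pow_mul_eq_div hy ((add_comm y x).trans hxy)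
  subst hm
  have e3 : p ^ d * (p - 1) * (p ^ (2 * (d * s)) - 1) / (p ^ d + 1) = y * (p - 1) := by
    rw [← hxy, ← hy, show p ^ d * (p - 1) * (x + x * p ^ d) = x * p ^ d * (p - 1) * (p ^ d + 1) by
      ring, Nat.mul_div_cancel _ (by omega)]
  have e4 : (p - 1) * (p ^ (2 * (d * s)) - 1) / (p ^ d + 1) = x * (p - 1) := by
    rw [← hxy, ← hy, show (p - 1) * (x + x * p ^ d) = x * (p - 1) * (p ^ d + 1) by
      ring, Nat.mul_div_cancel _ (by omega)]
  rw [e3, e4, ← e1, ← e2, show (2 * (d * s) - 2) / 2 = d * s - 1 by omega,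
    show (2 * (d * s) + 2 * d - 2) / 2 = d * s - 1 + d by omega]
  exact h.of_subset (by intro e; simp; tauto) (by intro e; simp; tauto)

lemma hasWeightDistribution_of_even_half (hp : p ≠ 2) {d s n : ℕ}
    (hK : Fintype.card K = p ^ (2 * (d * s))) (hd : 0 < d) (hs1 : 1 < s) (hs : Even s)
    (f : K × ZMod p →ₗ[ZMod p] (Fin n → ZMod p))
    (hf : ∀ a b, hammingNorm (f (a, b)) + levelCount (p ^ d + 1) a (-b) =
      p ^ (2 * (d * s)) - 1 + if b = 0 then 1 else 0) {m : ℕ} (hm : m = 2 * (d * s)) :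
    Function.Injective f ∧ HasWeightDistribution (LinearMap.range f)
      [(0, 1), (p ^ m - 1, p - 1),
       ((p - 1) * (p ^ (m - 1) - p ^ ((m - 2) / 2)), p ^ d * (p ^ m - 1) / (p ^ d + 1)),
       ((p - 1) * p ^ (m - 1) + p ^ ((m - 2) / 2) - 1,
          p ^ d * (p - 1) * (p ^ m - 1) / (p ^ d + 1)),
       ((p - 1) * (p ^ (m - 1) + p ^ ((m + 2 * d - 2) / 2)), (p ^ m - 1) / (p ^ d + 1)),
       ((p - 1) * p ^ (m - 1) - p ^ ((m + 2 * d - 2) / 2) - 1,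
          (p - 1) * (p ^ m - 1) / (p ^ d + 1))] := by
  have hp0 : 0 < p := (Fact.out : p.Prime).pos
  have he := sub_one_mul_pow_add_one_dvd (p := p) (d := d) (s := s) hp0
  have hds : d * 2 ≤ d * s := Nat.mul_le_mul_left d hs1
  obtain ⟨hinj, x, y, hxy, hxy', h⟩ := hasWeightDistribution_of_deviation hp (by omega) hK he
    (i := d * s - 1) (j := d * s - 1 + d) (by omega) (by omega) (by omega) (by omega) f hf
    (fun a ha => by
      have := deviation_eq hp hd (by omega) hK ha he
      rw [hs.neg_one_pow] at this
      simpa using this)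
  refine ⟨hinj, ?_⟩
  rw [pow_add] at hxy'
  have hx : y * p ^ d = x := by
    apply Nat.eq_of_mul_eq_mul_left (Nat.pow_pos hp0 : 0 < p ^ (d * s - 1))
    linarith
  obtain ⟨e1, e2⟩ := pow_mul_eq_div hx hxy
  subst hm
  have e3 : p ^ d * (p - 1) * (p ^ (2 * (d * s)) - 1) / (p ^ d + 1) = x * (p - 1) := by
    rw [← hxy, ← hx, show p ^ d * (p - 1) * (y * p ^ d + y) = y * p ^ d * (p - 1) * (p ^ d + 1) by
      ring, Nat.mul_div_cancel _ (by omega)]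
  have e4 : (p - 1) * (p ^ (2 * (d * s)) - 1) / (p ^ d + 1) = y * (p - 1) := by
    rw [← hxy, ← hx, show (p - 1) * (y * p ^ d + y) = y * (p - 1) * (p ^ d + 1) by
      ring, Nat.mul_div_cancel _ (by omega)]
  rw [e3, e4, ← e1, ← e2, show (2 * (d * s) - 2) / 2 = d * s - 1 by omega,
    show (2 * (d * s) + 2 * d - 2) / 2 = d * s - 1 + d by omega]
  exact h

end Cases

end CyclicCodes

/-! ### Assembly -/

theorem theorem2 (p m k : ℕ) [Fact p.Prime] (hp : p ≠ 2) (hk : 0 < k) (hkm : k < m)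
    (hm : m ≠ 2 * k) {K : Type*} [Field K] [Algebra (ZMod p) K] (hK : Nat.card K = p ^ m)
    (α : Kˣ) (hα : ∀ x : Kˣ, x ∈ Subgroup.zpowers α) (d : ℕ) (hd : d = Nat.gcd k m) :
    ((X - 1) * CyclicCodes.h₁ p k α ∣ (X ^ (p ^ m - 1) - 1 : (ZMod p)[X])) ∧
    CyclicCodes.IsCyclicCode (CyclicCodes.C₂ p m k α) ∧
    Module.finrank (ZMod p) (CyclicCodes.C₂ p m k α) = m + 1 ∧
    (0 = padicValNat 2 m ∧ padicValNat 2 m ≤ padicValNat 2 k →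
      CyclicCodes.HasWeightDistribution (CyclicCodes.C₂ p m k α)
        [(0, 1),
         (p ^ m - 1, p - 1),
         ((p - 1) * p ^ (m - 1), p ^ m - 1),
         ((p - 1) * p ^ (m - 1) - p ^ ((m - 1) / 2) - 1, (p - 1) / 2 * (p ^ m - 1)),
         ((p - 1) * p ^ (m - 1) + p ^ ((m - 1) / 2) - 1, (p - 1) / 2 * (p ^ m - 1))]) ∧
    (1 ≤ padicValNat 2 m ∧ padicValNat 2 m ≤ padicValNat 2 k →
      CyclicCodes.HasWeightDistribution (CyclicCodes.C₂ p m k α)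
        [(0, 1),
         (p ^ m - 1, p - 1),
         ((p - 1) * p ^ (m - 1) - p ^ ((m - 2) / 2) - 1, (p - 1) / 2 * (p ^ m - 1)),
         ((p - 1) * p ^ (m - 1) + p ^ ((m - 2) / 2) - 1, (p - 1) / 2 * (p ^ m - 1)),
         ((p - 1) * (p ^ (m - 1) - p ^ ((m - 2) / 2)), (p ^ m - 1) / 2),
         ((p - 1) * (p ^ (m - 1) + p ^ ((m - 2) / 2)), (p ^ m - 1) / 2)]) ∧
    (padicValNat 2 m = padicValNat 2 k + 1 →
      CyclicCodes.HasWeightDistribution (CyclicCodes.C₂ p m k α)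
        [(0, 1),
         (p ^ m - 1, p - 1),
         ((p - 1) * (p ^ (m - 1) + p ^ ((m - 2) / 2)), p ^ d * (p ^ m - 1) / (p ^ d + 1)),
         ((p - 1) * p ^ (m - 1) - p ^ ((m - 2) / 2) - 1,
            p ^ d * (p - 1) * (p ^ m - 1) / (p ^ d + 1)),
         ((p - 1) * (p ^ (m - 1) - p ^ ((m + 2 * d - 2) / 2)), (p ^ m - 1) / (p ^ d + 1)),
         ((p - 1) * p ^ (m - 1) + p ^ ((m + 2 * d - 2) / 2) - 1,
            (p - 1) * (p ^ m - 1) / (p ^ d + 1))]) ∧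
    (padicValNat 2 k + 1 < padicValNat 2 m →
      CyclicCodes.HasWeightDistribution (CyclicCodes.C₂ p m k α)
        [(0, 1),
         (p ^ m - 1, p - 1),
         ((p - 1) * (p ^ (m - 1) - p ^ ((m - 2) / 2)), p ^ d * (p ^ m - 1) / (p ^ d + 1)),
         ((p - 1) * p ^ (m - 1) + p ^ ((m - 2) / 2) - 1,
            p ^ d * (p - 1) * (p ^ m - 1) / (p ^ d + 1)),
         ((p - 1) * (p ^ (m - 1) + p ^ ((m + 2 * d - 2) / 2)), (p ^ m - 1) / (p ^ d + 1)),
         ((p - 1) * p ^ (m - 1) - p ^ ((m + 2 * d - 2) / 2) - 1,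
            (p - 1) * (p ^ m - 1) / (p ^ d + 1))]) ∧
    {w : ℕ | w ≠ 0 ∧ CyclicCodes.weightCount (CyclicCodes.C₂ p m k α) w ≠ 0}.ncard ≤ 5 := by
  have hp0 : 0 < p := (Fact.out : p.Prime).pos
  have hpo : Odd p := (Fact.out : p.Prime).odd_of_ne_two hp
  have hm0 : 0 < m := by omega
  have : Finite K := Nat.finite_of_card_ne_zero (by rw [hK]; positivity)
  have := Fintype.ofFinite K
  rw [Nat.card_eq_fintype_card] at hK
  set θ : K := (α : K) ^ (p ^ k + 1) with hθ
  have hn0 : 0 < p ^ m - 1 := by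
    have := Nat.one_lt_pow hm0.ne' (Fact.out : p.Prime).one_lt
    omega
  have hθ0 : θ ≠ 0 := pow_ne_zero _ α.ne_zero
  have hθn : θ ^ (p ^ m - 1) = 1 := by
    rw [← hK]; exact FiniteField.pow_card_sub_one_eq_one θ hθ0
  have hh₁ : CyclicCodes.h₁ p k α = minpoly (ZMod p) θ⁻¹ := by
    simp [CyclicCodes.h₁, hθ]
  have hdvd : (X - 1) * minpoly (ZMod p) θ⁻¹ ∣ (X ^ (p ^ m - 1) - 1 : (ZMod p)[X]) :=
    CyclicCodes.X_sub_one_mul_minpoly_dvd hn0 (by rw [inv_pow, hθn, inv_one])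
      (CyclicCodes.pow_pow_add_one_inv_ne_one hp hK hk hkm hα)
  set f := CyclicCodes.traceWord p (p ^ m - 1) θ with hf
  have hw : ∀ (a : K) (b : ZMod p), hammingNorm (f (a, b)) +
      CyclicCodes.levelCount ((p ^ k + 1).gcd (p ^ m - 1)) a (-b) =
      p ^ m - 1 + if b = 0 then 1 else 0 := by
    intro a b
    have hg := CyclicCodes.levelCount_gcd (Nat.succ_pos (p ^ k)) a (-b)
    rw [hK] at hg
    rw [← hg]
    exact CyclicCodes.hammingNorm_traceWord hK (Nat.succ_ne_zero _) hα a b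
  -- Identifying the code with the range of `f` needs injectivity, which comes out of the weight
  -- computation; so everything is first proved for the range.
  suffices key : Function.Injective f ∧
    (0 = padicValNat 2 m ∧ padicValNat 2 m ≤ padicValNat 2 k →
      CyclicCodes.HasWeightDistribution (LinearMap.range f)
        [(0, 1),
         (p ^ m - 1, p - 1),
         ((p - 1) * p ^ (m - 1), p ^ m - 1),
         ((p - 1) * p ^ (m - 1) - p ^ ((m - 1) / 2) - 1, (p - 1) / 2 * (p ^ m - 1)),
         ((p - 1) * p ^ (m - 1) + p ^ ((m - 1) / 2) - 1, (p - 1) / 2 * (p ^ m - 1))]) ∧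
    (1 ≤ padicValNat 2 m ∧ padicValNat 2 m ≤ padicValNat 2 k →
      CyclicCodes.HasWeightDistribution (LinearMap.range f)
        [(0, 1),
         (p ^ m - 1, p - 1),
         ((p - 1) * p ^ (m - 1) - p ^ ((m - 2) / 2) - 1, (p - 1) / 2 * (p ^ m - 1)),
         ((p - 1) * p ^ (m - 1) + p ^ ((m - 2) / 2) - 1, (p - 1) / 2 * (p ^ m - 1)),
         ((p - 1) * (p ^ (m - 1) - p ^ ((m - 2) / 2)), (p ^ m - 1) / 2),
         ((p - 1) * (p ^ (m - 1) + p ^ ((m - 2) / 2)), (p ^ m - 1) / 2)]) ∧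
    (padicValNat 2 m = padicValNat 2 k + 1 →
      CyclicCodes.HasWeightDistribution (LinearMap.range f)
        [(0, 1),
         (p ^ m - 1, p - 1),
         ((p - 1) * (p ^ (m - 1) + p ^ ((m - 2) / 2)), p ^ d * (p ^ m - 1) / (p ^ d + 1)),
         ((p - 1) * p ^ (m - 1) - p ^ ((m - 2) / 2) - 1,
            p ^ d * (p - 1) * (p ^ m - 1) / (p ^ d + 1)),
         ((p - 1) * (p ^ (m - 1) - p ^ ((m + 2 * d - 2) / 2)), (p ^ m - 1) / (p ^ d + 1)),
         ((p - 1) * p ^ (m - 1) + p ^ ((m + 2 * d - 2) / 2) - 1,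
            (p - 1) * (p ^ m - 1) / (p ^ d + 1))]) ∧
    (padicValNat 2 k + 1 < padicValNat 2 m →
      CyclicCodes.HasWeightDistribution (LinearMap.range f)
        [(0, 1),
         (p ^ m - 1, p - 1),
         ((p - 1) * (p ^ (m - 1) - p ^ ((m - 2) / 2)), p ^ d * (p ^ m - 1) / (p ^ d + 1)),
         ((p - 1) * p ^ (m - 1) + p ^ ((m - 2) / 2) - 1,
            p ^ d * (p - 1) * (p ^ m - 1) / (p ^ d + 1)),
         ((p - 1) * (p ^ (m - 1) + p ^ ((m + 2 * d - 2) / 2)), (p ^ m - 1) / (p ^ d + 1)),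
         ((p - 1) * p ^ (m - 1) - p ^ ((m + 2 * d - 2) / 2) - 1,
            (p - 1) * (p ^ m - 1) / (p ^ d + 1))]) ∧
    {w : ℕ | w ≠ 0 ∧ CyclicCodes.weightCount (LinearMap.range f) w ≠ 0}.ncard ≤ 5 by
    obtain ⟨hinj, key⟩ := key
    obtain ⟨hC, hdim⟩ := CyclicCodes.codeOfParityCheck_eq_range hK hn0 hθ0 hθn hdvd hinj
    have hC₂ : CyclicCodes.C₂ p m k α = LinearMap.range f := by
      rw [CyclicCodes.C₂, hh₁, hC]
    rw [hC₂, hh₁]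
    exact ⟨hdvd, CyclicCodes.isCyclicCode_range_traceWord hθ0 hθn, hdim, key⟩
  rcases Nat.lt_or_ge (padicValNat 2 k) (padicValNat 2 m) with hv | hv
  · obtain ⟨s, t, hms, hkt, ht, hts, hval⟩ := CyclicCodes.exists_of_padicValNat_lt hk hm0 hv
    rw [← hd] at hms hkt
    have hd0 : 0 < d := by rw [hd]; exact Nat.gcd_pos_of_pos_left _ hk
    have hs0 : s ≠ 0 := by rintro rfl; omega
    -- If s = 1, then k < m forces t = 1 and m = 2k, which is excluded.
    have hs1 : 1 < s := by
      by_contra hs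
      have : s = 1 := by omega
      subst this
      have h1 : d * t < d * 2 := by omega
      have h2 : t < 2 := Nat.lt_of_mul_lt_mul_left h1
      have h3 : t = 1 := by have := ht.pos; omega
      subst h3
      omega
    have hg : (p ^ k + 1).gcd (p ^ m - 1) = p ^ d + 1 := by
      rw [hms, hkt]
      exact CyclicCodes.gcd_pow_add_one_of_even hpo ht hts
    rw [hg] at hw
    by_cases hs : Odd s
    · have hs2 := (CyclicCodes.padicValNat_two_eq_zero_iff hs0).mpr hs
      obtain ⟨hinj, hdist⟩ := CyclicCodes.hasWeightDistribution_of_odd_half hp (hms ▸ hK) hd0 hs1 hs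
        f (by rw [← hms]; exact hw) hms
      exact ⟨hinj, fun h => by omega, fun h => by omega, fun _ => hdist, fun h => by omega,
        hdist.ncard_nonzero_le⟩
    · have hs2 := fun h => hs ((CyclicCodes.padicValNat_two_eq_zero_iff hs0).mp h)
      obtain ⟨hinj, hdist⟩ := CyclicCodes.hasWeightDistribution_of_even_half hp (hms ▸ hK) hd0 hs1
        (Nat.not_odd_iff_even.mp hs) f (by rw [← hms]; exact hw) hms
      exact ⟨hinj, fun h => by omega, fun h => by omega, fun h => absurd (by omega) hs2,
        fun _ => hdist, hdist.ncard_nonzero_le⟩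
  · rw [CyclicCodes.gcd_pow_add_one_of_odd hpo
      (CyclicCodes.odd_div_gcd_of_padicValNat_le hk hm0 hv)] at hw
    by_cases hmo : Odd m
    · have hm2 := (CyclicCodes.padicValNat_two_eq_zero_iff hm0.ne').mpr hmo
      obtain ⟨hinj, hdist⟩ := CyclicCodes.hasWeightDistribution_of_odd hp hK hmo (by omega) f hw
      exact ⟨hinj, fun _ => hdist, fun h => by omega, fun h => by omega, fun h => by omega,
        hdist.ncard_nonzero_le.trans (by simp)⟩
    · have hm2 := fun h => hmo ((CyclicCodes.padicValNat_two_eq_zero_iff hm0.ne').mp h)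
      obtain ⟨r, hr⟩ := even_iff_two_dvd.mp (Nat.not_odd_iff_even.mp hmo)
      subst hr
      -- Here r > 1, because m = 2 would force k = 1 and m = 2k.
      obtain ⟨hinj, hdist⟩ := CyclicCodes.hasWeightDistribution_of_two_mul hp hK (by omega) f hw
      exact ⟨hinj, fun h => absurd h.1.symm hm2, fun _ => hdist, fun h => by omega,
        fun h => by omega, hdist.ncard_nonzero_le⟩
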